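/- Let $p$ be a prime and let $k$ be a field of characteristic $p$. Let $P$ be a non-trivial finite abelian $p$-group and let $E$ be an abelian subgroup of $\mathrm{Aut}(P)$ of order prime to $p$. Suppose that $[P,E]=P$, where $[P,E]$ is the subgroup of $P$ generated by the elements $({}^e u)u^{-1}$ with $u\in P$ and $e\in E$. Let $\alpha\in Z^2(E;k^\times)$ be a $2$-cocycle (for the trivial action of $E$ on $k^\times$), and denote by $\alpha$ also its inflation to $P\rtimes E$ via the canonical surjection $P\rtimes E\to E$. Let $A=k_\alpha(P\rtimes E)$ be the twisted group algebra, that is, the $k$-algebra with $k$-basis $\{\hat g : g\in P\rtimes E\}$ and multiplication $\hat g\hat h=\alpha(g,h)\,\widehat{gh}$. Let $\mathrm{HH}^1(A)=\mathrm{Der}(A)/\mathrm{IDer}(A)$ be the Lie algebra of $k$-linear derivations of $A$ modulo inner derivations, with bracket induced by $[f,g]=f\circ g-g\circ f$. Let $\Phi(P)$ be the Frattini subgroup of $P$, and regard $P/\Phi(P)$ as an $\mathbb F_pE$-module via the action of $E$ on $P$. A semisimple module is called multiplicity free if it is a direct sum of pairwise non-isomorphic simple modules. Then the following hold. (i) Every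 class in $\mathrm{HH}^1(A)$ is represented by a derivation on $A$ with image contained in the Jacobson radical $J(A)$. (ii) If the $\mathbb F_pE$-module $P/\Phi(P)$ is multiplicity free, then the Lie algebra $\mathrm{HH}^1(A)$ is solvable. The converse holds if $p$ is odd. -/

import Mathlib

universe u v

/-! ### First Hochschild cohomology of an algebra as a Lie algebra -/

section HochschildOne

attribute [local instance 100] LieRing.ofAssociativeRing

variable (k : Type u) [CommRing k] (A : Type v) [Ring A] [Algebra k A]

/-- The Lie algebra `Der(A)` of `k`-linear derivations of a (not necessarily commutative) algebra
`A`, inside `End_k(A)` with the bracket `[f, g] = f ∘ g - g ∘ f`. -/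
def derivationAlgebra : LieSubalgebra k (Module.End k A) where
  carrier := {f | ∀ a b : A, f (a * b) = f a * b + a * f b}
  zero_mem' := by intro a b; simp
  add_mem' := by
    intro f g hf hg a b
    simp only [LinearMap.add_apply, hf a b, hg a b, add_mul, mul_add]
    abel
  smul_mem' := by
    intro c f hf a b
    simp only [LinearMap.smul_apply, hf a b, smul_add, smul_mul_assoc, mul_smul_comm]
  lie_mem' := by
    intro f g hf hg a b
    have hf' : ∀ a b : A, f (a * b) = f a * b + a * f b := hf
    have hg' : ∀ a b : A, g (a * b) = g a * b + a * g b := hg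
    simp only [Ring.lie_def, LinearMap.sub_apply, Module.End.mul_apply, hf', hg', map_add,
      sub_mul, mul_sub]
    abel

/-- The Lie ideal `IDer(A)` of inner derivations `[c, -] : a ↦ c * a - a * c`. -/
def innerDerivations : LieIdeal k (derivationAlgebra k A) where
  carrier := {f | ∃ c : A, ∀ a : A, f.1 a = c * a - a * c}
  zero_mem' := ⟨0, by intro a; simp⟩
  add_mem' := by
    rintro f g ⟨c, hc⟩ ⟨d, hd⟩
    refine ⟨c + d, fun a => ?_⟩
    have h : (f + g).1 a = f.1 a + g.1 a := rfl
    rw [h, hc, hd, add_mul, mul_add]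
    abel
  smul_mem' := by
    rintro r f ⟨c, hc⟩
    refine ⟨r • c, fun a => ?_⟩
    have h : (r • f).1 a = r • f.1 a := rfl
    rw [h, hc, smul_sub, smul_mul_assoc, mul_smul_comm]
  lie_mem := by
    rintro f g ⟨c, hc⟩
    refine ⟨f.1 c, fun a => ?_⟩
    have hf : ∀ a b : A, f.1 (a * b) = f.1 a * b + a * f.1 b := f.2
    have h : (⁅f, g⁆ : derivationAlgebra k A).1 a = f.1 (g.1 a) - g.1 (f.1 a) := rfl
    rw [h, hc, hc, map_sub, hf, hf]
    abel

/-- The Lie algebra `HH¹(A) = Der(A) / IDer(A)`. -/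
abbrev HochschildOne : Type v := derivationAlgebra k A ⧸ innerDerivations k A

/-- The class in `HH¹(A)` of a derivation. -/
abbrev HochschildOne.mk (f : derivationAlgebra k A) : HochschildOne k A :=
  LieSubmodule.Quotient.mk f

end HochschildOne

/-! ### Twisted group algebras -/

/-- A `2`-cocycle of `G` with values in `kˣ`, where `G` acts trivially on `kˣ`
(not assumed to be normalised); the set of these is `Z²(G; kˣ)`. -/
structure TwoCocycle (G : Type u) [Group G] (k : Type v) [Field k] where
  /-- the underlying function -/
  toFun : G → G → kˣ
  cocycle : ∀ x y z : G, toFun x y * toFun (x * y) z = toFun y z * toFun x (y * z)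

/-- Inflation of a `2`-cocycle along a group homomorphism `π : H → G`. -/
def TwoCocycle.inflate {G : Type*} [Group G] {H : Type*} [Group H] {k : Type*} [Field k]
    (α : TwoCocycle G k) (π : H →* G) : TwoCocycle H k where
  toFun x y := α.toFun (π x) (π y)
  cocycle x y z := by simpa using α.cocycle (π x) (π y) (π z)

/-- The twisted group algebra `k_α G`: the `k`-vector space with basis `ĝ` (`g ∈ G`), where `ĝ` is
`Finsupp.single g 1`, and with the multiplication `ĝ ĥ = α(g, h) (gh)^`, extended bilinearly. -/
def TwistedGroupAlgebra {G : Type u} [Group G] {k : Type v} [Field k] (_ : TwoCocycle G k) :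
    Type (max u v) :=
  G →₀ k

namespace TwistedGroupAlgebra

variable {G : Type u} [Group G] {k : Type v} [Field k] (α : TwoCocycle G k)

noncomputable instance : AddCommGroup (TwistedGroupAlgebra α) :=
  inferInstanceAs (AddCommGroup (G →₀ k))

noncomputable instance : Module k (TwistedGroupAlgebra α) :=
  inferInstanceAs (Module k (G →₀ k))

/-- The element `r ĝ`. -/
noncomputable def single (g : G) (r : k) : TwistedGroupAlgebra α :=
  (Finsupp.single g r : G →₀ k)

/-- Left multiplication by `ĝ`, given on basis elements by `ĝ ĥ = α(g, h) (gh)^`. -/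
noncomputable def mulLeftBasis (g : G) : TwistedGroupAlgebra α →ₗ[k] TwistedGroupAlgebra α :=
  Finsupp.linearCombination k fun h : G => single α (g * h) (α.toFun g h : k)

/-- The bilinear multiplication, given on basis elements by `ĝ ĥ = α(g, h) (gh)^`. -/
noncomputable def mulBilin :
    TwistedGroupAlgebra α →ₗ[k] TwistedGroupAlgebra α →ₗ[k] TwistedGroupAlgebra α :=
  Finsupp.linearCombination k (mulLeftBasis α)

noncomputable instance : Mul (TwistedGroupAlgebra α) := ⟨fun a b => mulBilin α a b⟩

noncomputable instance : One (TwistedGroupAlgebra α) :=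
  ⟨single α 1 ((α.toFun 1 1)⁻¹ : kˣ)⟩

theorem mul_def (a b : TwistedGroupAlgebra α) : a * b = mulBilin α a b := rfl

theorem one_def : (1 : TwistedGroupAlgebra α) = single α 1 ((α.toFun 1 1)⁻¹ : kˣ) := rfl

theorem smul_single (g : G) (r s : k) : r • single α g s = single α g (r * s) :=
  Finsupp.smul_single' r g s

theorem single_mul_single (g h : G) (r s : k) :
    single α g r * single α h s = single α (g * h) (r * s * α.toFun g h) := by
  have h1 : mulBilin α (single α g r) = r • mulLeftBasis α g :=
    Finsupp.linearCombination_single k r g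
  have h2 : mulLeftBasis α g (single α h s) = s • single α (g * h) (α.toFun g h : k) :=
    Finsupp.linearCombination_single k s h
  rw [mul_def, h1, LinearMap.smul_apply, h2]
  simp only [smul_single, mul_assoc]

theorem induction {motive : TwistedGroupAlgebra α → Prop} (a : TwistedGroupAlgebra α)
    (zero : motive 0) (add : ∀ a b, motive a → motive b → motive (a + b))
    (single : ∀ g r, motive (single α g r)) : motive a :=
  Finsupp.induction_linear (motive := motive) a zero add single

noncomputable instance : NonUnitalNonAssocRing (TwistedGroupAlgebra α) where
  left_distrib a b c := by simp only [mul_def, map_add]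
  right_distrib a b c := by simp only [mul_def, map_add, LinearMap.add_apply]
  zero_mul a := by simp only [mul_def, map_zero, LinearMap.zero_apply]
  mul_zero a := by simp only [mul_def, map_zero]

protected theorem mul_assoc (a b c : TwistedGroupAlgebra α) : a * b * c = a * (b * c) := by
  induction a using induction with
  | zero => simp only [zero_mul]
  | add a a' h h' => simp only [add_mul, h, h']
  | single x r =>
    induction b using induction with
    | zero => simp only [zero_mul, mul_zero]
    | add b b' h h' => simp only [add_mul, mul_add, h, h']
    | single y s =>
      induction c using induction with
      | zero => simp only [mul_zero]
      | add c c' h h' => simp only [mul_add, h, h']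
      | single z t =>
        have hc := congrArg (Units.val) (α.cocycle x y z)
        simp only [Units.val_mul] at hc
        simp only [single_mul_single, mul_assoc x y z]
        congr 1
        linear_combination (r * s * t) * hc

protected theorem one_mul (a : TwistedGroupAlgebra α) : 1 * a = a := by
  induction a using induction with
  | zero => simp only [mul_zero]
  | add a a' h h' => simp only [mul_add, h, h']
  | single x r =>
    have hc := α.cocycle 1 1 x
    rw [one_mul, one_mul, mul_left_inj] at hc
    rw [one_def, single_mul_single, one_mul, ← hc, mul_right_comm, Units.inv_mul, one_mul]

protected theorem mul_one (a : TwistedGroupAlgebra α) : a * 1 = a := by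
  induction a using induction with
  | zero => simp only [zero_mul]
  | add a a' h h' => simp only [add_mul, h, h']
  | single x r =>
    have hc := α.cocycle x 1 1
    rw [mul_one, mul_one, mul_left_inj] at hc
    rw [one_def, single_mul_single, mul_one, hc, mul_assoc, Units.inv_mul, mul_one]

noncomputable instance : Ring (TwistedGroupAlgebra α) :=
  { (inferInstance : NonUnitalNonAssocRing (TwistedGroupAlgebra α)) with
    mul_assoc := TwistedGroupAlgebra.mul_assoc α
    one_mul := TwistedGroupAlgebra.one_mul α
    mul_one := TwistedGroupAlgebra.mul_one α }

noncomputable instance : Algebra k (TwistedGroupAlgebra α) :=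
  Algebra.ofModule
    (fun r a b => by simp only [mul_def, map_smul, LinearMap.smul_apply])
    (fun r a b => by simp only [mul_def, map_smul])

end TwistedGroupAlgebra

/-! ### Groups of automorphisms of `p`-groups and the module `P / Φ(P)` -/

/-- `[P, E]`, the subgroup of `P` generated by the elements `(ᵉu) u⁻¹` with `u ∈ P`, `e ∈ E`. -/
def autCommutator {P : Type*} [Group P] (E : Subgroup (MulAut P)) : Subgroup P :=
  Subgroup.closure {x | ∃ e ∈ E, ∃ u : P, x = e u * u⁻¹}

/-- A module is multiplicity free if it is the (internal) direct sum of simple submodules which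
are pairwise non-isomorphic. -/
def IsMultiplicityFree (R : Type*) [Ring R] (M : Type*) [AddCommGroup M] [Module R M] : Prop :=
  ∃ 𝒮 : Set (Submodule R M), (∀ S ∈ 𝒮, IsSimpleModule R S) ∧ sSupIndep 𝒮 ∧ sSup 𝒮 = ⊤ ∧
    𝒮.Pairwise fun S T => IsEmpty (S ≃ₗ[R] T)

theorem pow_mem_frattini {p : ℕ} {P : Type*} [CommGroup P] (hP : IsPGroup p P) (x : P) :
    x ^ p ∈ frattini P := by
  simp only [frattini, Order.radical, Subgroup.mem_iInf]
  intro M hM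
  by_contra hx
  have htop : M ⊔ Subgroup.zpowers (x ^ p) = ⊤ :=
    hM.2 _ (left_lt_sup.2 fun h => hx (h (Subgroup.mem_zpowers _)))
  have hxm : x ∈ M ⊔ Subgroup.zpowers (x ^ p) := htop ▸ Subgroup.mem_top x
  obtain ⟨m, hm, y, hy, hmy⟩ := Subgroup.mem_sup.1 hxm
  obtain ⟨n, rfl⟩ := Subgroup.mem_zpowers_iff.1 hy
  obtain ⟨j, hj⟩ := hP x
  have hm' : m = x ^ (1 - (p : ℤ) * n) := by
    rw [zpow_sub, zpow_one, zpow_mul, zpow_natCast]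
    exact eq_mul_inv_of_mul_eq hmy
  have hcop : IsCoprime (1 - (p : ℤ) * n) ((p : ℤ) ^ j) :=
    IsCoprime.pow_right ⟨1, n, by ring⟩
  obtain ⟨a, b, hab⟩ := hcop
  have hxM : x ∈ M := by
    have : x = m ^ a := by
      have hj' : x ^ ((p : ℤ) ^ j) = 1 := by exact_mod_cast hj
      rw [hm', ← zpow_mul]
      calc x = x ^ (a * (1 - (p : ℤ) * n) + b * (p : ℤ) ^ j) := by rw [hab, zpow_one]
        _ = x ^ ((1 - (p : ℤ) * n) * a) := by
          rw [zpow_add, mul_comm b, zpow_mul x _ b, hj', one_zpow, mul_one, mul_comm]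
    rw [this]
    exact M.zpow_mem hm a
  exact hx (M.pow_mem hxM p)

/-- The quotient `P / Φ(P)` of an abelian `p`-group by its Frattini subgroup, written
additively. -/
def FrattiniQuotient {p : ℕ} {P : Type u} [CommGroup P] (_ : IsPGroup p P) : Type u :=
  Additive (P ⧸ frattini P)

namespace FrattiniQuotient

variable {p : ℕ} {P : Type u} [CommGroup P] (hP : IsPGroup p P)

instance : AddCommGroup (FrattiniQuotient hP) :=
  inferInstanceAs (AddCommGroup (Additive (P ⧸ frattini P)))

/-- The `𝔽_p`-vector space structure on the elementary abelian group `P / Φ(P)`. -/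
instance : Module (ZMod p) (FrattiniQuotient hP) :=
  AddCommGroup.zmodModule (n := p) (G := Additive (P ⧸ frattini P)) fun x => by
    induction x using Additive.rec with
    | ofMul x =>
      induction x using QuotientGroup.induction_on with
      | H x => exact congrArg Additive.ofMul ((QuotientGroup.eq_one_iff _).2 (pow_mem_frattini hP x))

/-- The class of `x ∈ P` in `P / Φ(P)`. -/
def mk (x : P) : FrattiniQuotient hP := Additive.ofMul (x : P ⧸ frattini P)

theorem mk_surjective : Function.Surjective (mk hP) := fun x =>
  QuotientGroup.mk_surjective (s := frattini P) (Additive.toMul x)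

/-- The additive map of `P / Φ(P)` induced by an automorphism of `P`. -/
def map (e : MulAut P) : FrattiniQuotient hP →+ FrattiniQuotient hP :=
  MonoidHom.toAdditive (QuotientGroup.map (frattini P) (frattini P) e.toMonoidHom
    (Subgroup.characteristic_iff_le_comap.1 frattini_characteristic e))

theorem map_mk (e : MulAut P) (x : P) : map hP e (mk hP x) = mk hP (e x) := rfl

/-- The representation of a group `E` of automorphisms of `P` on the `𝔽_p`-vector space
`P / Φ(P)`, with `e ∈ E` sending the class of `x` to the class of `e(x)`. -/
def representation (E : Subgroup (MulAut P)) :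
    Representation (ZMod p) E (FrattiniQuotient hP) where
  toFun e := AddMonoidHom.toZModLinearMap p (map hP (e : MulAut P))
  map_one' := by
    ext x
    obtain ⟨x, rfl⟩ := mk_surjective hP x
    exact map_mk hP 1 x
  map_mul' e f := by
    ext x
    obtain ⟨x, rfl⟩ := mk_surjective hP x
    exact map_mk hP (e * f) x

end FrattiniQuotient

/-! Write A = ⊕ k[P]ê over e ∈ E, and let I be the augmentation ideal of k[P]. Since I is nilpotent
and E-stable, the subspaces IⁿA (`filt`) form a multiplicative filtration that reaches zero, so IA
lies in the Jacobson radical.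

Every class in HH¹(A) has a representative D that kills each ê and sends k[P] into I + I²A
(`exists_representative`). An average over E, whose order is invertible in k, makes D vanish on
every ê. The component at ê of the restriction of D to k[P] is a derivation twisted by e. For e ≠ 1
it is inner modulo I², because e acts coprimely on P (`exists_twistedDerivation_sub_mem_sq`). For e
= 1 it is an E-equivariant derivation of k[P]; followed by the augmentation it gives an E-invariant
homomorphism P → k, which is trivial as [P, E] = P. A second average restores D(ê) = 0. Then D(A) ⊆
IA, which is (i).

For (ii), such a D acts on I/I² through its component at 1 and commutes with E. If P/Φ(P) is
multiplicity free, it is cyclic over the commutative ring 𝔽_pE by the Chinese remainder theorem. So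
I/I² is generated by one class w - 1 under kE, and its equivariant endomorphisms commute. Brackets
of representatives therefore send k[P] into I²A, and from there every further bracket raises the
degree, so HH¹(A) is solvable.

Conversely, let s be an E-equivariant additive lift of u ↦ u - 1 from P/Φ(P) to k[P]. An
endomorphism T of P/Φ(P) yields the derivation uê ↦ s(T(u)) uê, and modulo I²A brackets correspond
to commutators. If T ≠ 0 the class is nonzero, because an inner derivation has zero component at 1
on the commutative ring k[P]. When the semisimple module P/Φ(P) is not multiplicity free, its
endomorphism ring contains an 𝔰𝔩₂-triple, which for odd p reproduces itself in every term of the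
derived series. -/

namespace MonoidAlgebra

/-! ### The augmentation ideal I of k[P] and the map u ↦ u - 1 to I/I² -/

section Augmentation

variable (k : Type v) [Field k] (P : Type u) [CommGroup P]

/-- The augmentation ideal of a commutative group algebra. -/
noncomputable def augIdeal : Ideal (MonoidAlgebra k P) :=
  RingHom.ker (lift k k P (1 : P →* k))

variable {k P}

theorem of_sub_one_mem_augIdeal (u : P) : of k P u - 1 ∈ augIdeal k P := by
  simp [augIdeal, RingHom.mem_ker]

theorem sub_augmentation_mem_span (x : MonoidAlgebra k P) :
    x - algebraMap k _ (lift k k P (1 : P →* k) x) ∈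
      Submodule.span k (Set.range fun u : P => of k P u - 1) := by
  induction x using induction_linear with
  | zero => simp
  | add x y hx hy =>
    rw [map_add, map_add, add_sub_add_comm]
    exact add_mem hx hy
  | single u r =>
    have : single u r - algebraMap k (MonoidAlgebra k P) (lift k k P (1 : P →* k) (single u r)) =
        r • (of k P u - 1) := by
      simp [smul_sub, Algebra.algebraMap_eq_smul_one]
    rw [this]
    exact Submodule.smul_mem _ _ (Submodule.subset_span ⟨u, rfl⟩)

theorem mem_augIdeal_iff_mem_span {x : MonoidAlgebra k P} :
    x ∈ augIdeal k P ↔ x ∈ Submodule.span k (Set.range fun u : P => of k P u - 1) := by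
  constructor
  · intro hx
    have h := sub_augmentation_mem_span x
    rwa [show lift k k P (1 : P →* k) x = 0 from hx, map_zero, sub_zero] at h
  · intro hx
    have : Submodule.span k (Set.range fun u : P => of k P u - 1) ≤
        (augIdeal k P).restrictScalars k := by
      rw [Submodule.span_le]
      rintro _ ⟨u, rfl⟩
      exact of_sub_one_mem_augIdeal u
    exact this hx

/-- A linear map out of a commutative group algebra which sends all `u - 1` into a subspace sends
the augmentation ideal into it. -/
theorem map_augIdeal_mem {M : Type*} [AddCommGroup M] [Module k M]
    (f : MonoidAlgebra k P →ₗ[k] M) (N : Submodule k M) (h : ∀ u : P, f (of k P u - 1) ∈ N)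
    {x : MonoidAlgebra k P} (hx : x ∈ augIdeal k P) : f x ∈ N := by
  have : Submodule.span k (Set.range fun u : P => of k P u - 1) ≤ N.comap f := by
    rw [Submodule.span_le]
    rintro _ ⟨u, rfl⟩
    exact h u
  exact this (mem_augIdeal_iff_mem_span.1 hx)

/-- A linear map out of a group algebra takes values in a subspace as soon as it does on the
group. -/
theorem map_mem_of_forall_of {M : Type*} [AddCommGroup M] [Module k M]
    (f : MonoidAlgebra k P →ₗ[k] M) (N : Submodule k M) (h : ∀ u : P, f (of k P u) ∈ N)
    (x : MonoidAlgebra k P) : f x ∈ N := by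
  induction x using induction_linear with
  | zero => simp
  | add x y hx hy => rw [map_add]; exact add_mem hx hy
  | single u r =>
    have : single u r = r • of k P u := by simp
    rw [this, map_smul]
    exact N.smul_mem _ (h u)

theorem mem_augIdeal_sq_of_mul {x y : MonoidAlgebra k P} (hx : x ∈ augIdeal k P)
    (hy : y ∈ augIdeal k P) : x * y ∈ augIdeal k P ^ 2 := by
  rw [pow_two]
  exact Ideal.mul_mem_mul hx hy

theorem augIdeal_pow_le (n : ℕ) : augIdeal k P ^ (n + 1) ≤ augIdeal k P ^ n :=
  Ideal.pow_le_pow_right n.le_succ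

/-- In characteristic p, (u - 1)^(pⁿ) = u^(pⁿ) - 1, so the spanning elements u - 1 are nilpotent; a
finitely generated ideal inside the nilradical is nilpotent. -/
theorem augIdeal_isNilpotent {p : ℕ} [Fact p.Prime] [CharP k p] [Finite P] (hP : IsPGroup p P) :
    ∃ n, augIdeal k P ^ n = ⊥ := by
  have : CharP (MonoidAlgebra k P) p := charP_of_injective_algebraMap
    (FaithfulSMul.algebraMap_injective k (MonoidAlgebra k P)) p
  have : ExpChar (MonoidAlgebra k P) p := ExpChar.prime Fact.out
  have : Module.Finite k (MonoidAlgebra k P) := inferInstance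
  have : IsNoetherianRing (MonoidAlgebra k P) := isNoetherian_of_tower k inferInstance
  have hnil : augIdeal k P ≤ nilradical (MonoidAlgebra k P) := by
    intro x hx
    refine map_augIdeal_mem LinearMap.id ((nilradical (MonoidAlgebra k P)).restrictScalars k)
      (fun u => ?_) hx
    obtain ⟨n, hn⟩ := hP u
    refine ⟨p ^ n, ?_⟩
    rw [LinearMap.id_apply, sub_pow_expChar_pow, ← map_pow, hn, map_one, one_pow, sub_self]
    exact zero_mem _
  obtain ⟨n, hn⟩ := (Ideal.FG.isNilpotent_iff_le_nilradical (IsNoetherian.noetherian _)).2 hnil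
  exact ⟨n, hn⟩

variable (k) in
/-- The automorphism of a group algebra induced by an automorphism of the group. -/
noncomputable abbrev act (e : MulAut P) : MonoidAlgebra k P ≃ₐ[k] MonoidAlgebra k P :=
  domCongr k k e

theorem act_of (e : MulAut P) (u : P) : act k e (of k P u) = of k P (e u) := by
  simp

theorem act_act (e f : MulAut P) (x : MonoidAlgebra k P) :
    act k e (act k f x) = act k (e * f) x := by
  induction x using induction_linear with
  | zero => simp
  | add x y hx hy => simp only [map_add, hx, hy]
  | single u r =>
    have : single u r = r • of k P u := by simp
    rw [this, map_smul, map_smul, map_smul, act_of, act_of, act_of, MulAut.mul_apply]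

theorem act_one (x : MonoidAlgebra k P) : act k (1 : MulAut P) x = x := by
  induction x using induction_linear with
  | zero => simp
  | add x y hx hy => simp only [map_add, hx, hy]
  | single u r =>
    have : single u r = r • of k P u := by simp
    rw [this, map_smul, act_of, MulAut.one_apply]

theorem act_mem_augIdeal_pow (e : MulAut P) {n : ℕ} {x : MonoidAlgebra k P}
    (hx : x ∈ augIdeal k P ^ n) : act k e x ∈ augIdeal k P ^ n := by
  have h1 : augIdeal k P ≤ (augIdeal k P).comap (act k e) := by
    intro y hy
    refine map_augIdeal_mem (act k e).toLinearMap ((augIdeal k P).restrictScalars k)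
      (fun u => ?_) hy
    have h := of_sub_one_mem_augIdeal (k := k) (e u)
    rwa [← act_of, ← map_one (act k e), ← map_sub] at h
  have h2 := Ideal.pow_right_mono h1 n
  exact (Ideal.le_comap_pow (act k e : MonoidAlgebra k P →+* MonoidAlgebra k P) n) (h2 hx)

theorem of_mul_sub_one_congr (u v : P) :
    (of k P (u * v) - 1) - ((of k P u - 1) + (of k P v - 1)) ∈ augIdeal k P ^ 2 := by
  have : (of k P (u * v) - 1) - ((of k P u - 1) + (of k P v - 1)) =
      (of k P u - 1) * (of k P v - 1) := by
    rw [map_mul]; ring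
  rw [this]
  exact mem_augIdeal_sq_of_mul (of_sub_one_mem_augIdeal u) (of_sub_one_mem_augIdeal v)

variable (k P) in
/-- The homomorphism `u ↦ u - 1` from the group to the square-zero quotient `I / I²` of the group
algebra. -/
noncomputable def augClass : Additive P →+ MonoidAlgebra k P ⧸ augIdeal k P ^ 2 where
  toFun u := Ideal.Quotient.mk _ (of k P u.toMul - 1)
  map_zero' := by rw [toMul_zero, map_one, sub_self, map_zero]
  map_add' u v := by
    rw [← map_add, Ideal.Quotient.eq]
    exact of_mul_sub_one_congr _ _

theorem augClass_ofMul (u : P) :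
    augClass k P (Additive.ofMul u) = Ideal.Quotient.mk _ (of k P u - 1) := rfl

theorem augClass_eq_zero_iff (u : P) :
    augClass k P (Additive.ofMul u) = 0 ↔ of k P u - 1 ∈ augIdeal k P ^ 2 := by
  rw [augClass_ofMul, Ideal.Quotient.eq_zero_iff_mem]

end Augmentation

end MonoidAlgebra

/-! ### Coprime automorphisms of abelian p-groups -/

/-- The endomorphism `u ↦ e(u) u⁻¹` of an abelian group. -/
def MulAut.displacement {P : Type*} [CommGroup P] (e : MulAut P) : P →* P where
  toFun u := e u * u⁻¹
  map_one' := by simp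
  map_mul' u v := by
    rw [map_mul, mul_inv, mul_mul_mul_comm]

namespace MulAut

variable {P : Type*} [CommGroup P] {p : ℕ}

theorem displacement_apply (e : MulAut P) (u : P) : e.displacement u = e u * u⁻¹ := rfl

theorem apply_eq_displacement_mul (e : MulAut P) (u : P) : e u = e.displacement u * u := by
  simp [displacement_apply]

/-- If y = e(w)w⁻¹ is fixed by e, then eⁿ(w) = yⁿw. Hence yᵐ = 1, while y has p-power order and m is
prime to p. -/
theorem displacement_eq_one_of_displacement_displacement (hP : IsPGroup p P) {e : MulAut P} {m : ℕ}
    (hm : m.Coprime p) (hem : e ^ m = 1) {w : P}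
    (hw : e.displacement (e.displacement w) = 1) : e.displacement w = 1 := by
  set y := e.displacement w with hy
  have hey : e y = y := by rw [apply_eq_displacement_mul, hw, one_mul]
  have hpow : ∀ n : ℕ, (e ^ n) w = y ^ n * w := by
    intro n
    induction n with
    | zero => simp
    | succ n ih =>
      rw [pow_succ', MulAut.mul_apply, ih, map_mul, map_pow, hey, apply_eq_displacement_mul e w,
        ← hy, ← mul_assoc, ← pow_succ]
  have h1 : y ^ m = 1 := by
    have := hpow m
    rw [hem, MulAut.one_apply] at this
    exact (eq_comm.trans mul_eq_right).1 this
  obtain ⟨n, hn⟩ := hP y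
  have hc : m.Coprime (p ^ n) := Nat.Coprime.pow_right n hm
  have := Nat.dvd_gcd (orderOf_dvd_of_pow_eq_one h1) (orderOf_dvd_of_pow_eq_one hn)
  rw [hc.gcd_eq_one, Nat.dvd_one, orderOf_eq_one_iff] at this
  exact this

/-- This is the coprime decomposition P = C_P(e) × [P, e] in the form needed below: u ↦ e(u)u⁻¹ has
kernel C_P(e) and permutes its own image. -/
theorem displacement_bijective_range [Finite P] (hP : IsPGroup p P) {e : MulAut P} {m : ℕ}
    (hm : m.Coprime p) (hem : e ^ m = 1) :
    Function.Bijective (fun q : e.displacement.range =>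
      (⟨e.displacement q, q, rfl⟩ : e.displacement.range)) := by
  refine Finite.injective_iff_bijective.1 ?_
  rintro ⟨_, a, rfl⟩ ⟨_, b, rfl⟩ h
  have h' : e.displacement (e.displacement a) = e.displacement (e.displacement b) :=
    congrArg Subtype.val h
  have : e.displacement (e.displacement (a * b⁻¹)) = 1 := by
    simp only [map_mul, map_inv, h', mul_inv_cancel]
  have := displacement_eq_one_of_displacement_displacement hP hm hem this
  rw [map_mul, map_inv, mul_inv_eq_one] at this
  exact Subtype.ext this

end MulAut

/-! ### Derivations of k[P] twisted by a coprime automorphism -/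

namespace MonoidAlgebra

open MulAut

section Projection

variable {k : Type v} [Field k] {P : Type u} [CommGroup P]

variable (k) in
/-- The projection of a group algebra onto the span of the fixed points of an automorphism. -/
noncomputable def fixedProj (e : MulAut P) : MonoidAlgebra k P →ₗ[k] MonoidAlgebra k P :=
  open Classical in
  (Finsupp.linearCombination k fun u : P =>
    if e.displacement u = 1 then of k P u else 0) ∘ₗ (coeffLinearEquiv k).toLinearMap

open Classical in
theorem fixedProj_of (e : MulAut P) (u : P) :
    fixedProj k e (of k P u) = if e.displacement u = 1 then of k P u else 0 := by
  simp [fixedProj]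

/-- Let φ be the displacement and Q its image. For g ∈ P exactly one q ∈ Q makes gφ(q) fixed by e,
because φ permutes Q; only that summand survives, and it returns g. This is the decomposition of
k[P] along the cosets of C_P(e). -/
theorem sum_fixedProj [Finite P] {p : ℕ} (hP : IsPGroup p P) {e : MulAut P} {m : ℕ}
    (hm : m.Coprime p) (hem : e ^ m = 1) [Fintype e.displacement.range] (y : MonoidAlgebra k P) :
    ∑ q : e.displacement.range,
      fixedProj k e (y * of k P (e.displacement q)) * of k P (e.displacement q)⁻¹ = y := by
  classical
  induction y using induction_linear with
  | zero => simp
  | add x y hx hy =>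
    simp only [add_mul, map_add, Finset.sum_add_distrib, hx, hy]
  | single g r =>
    have hg : single g r = r • of k P g := by simp
    obtain ⟨q', hq'⟩ := (displacement_bijective_range hP hm hem).2 ⟨_, g⁻¹, rfl⟩
    obtain ⟨q, rfl⟩ := (displacement_bijective_range hP hm hem).2 q'
    have hq : e.displacement (e.displacement q) = (e.displacement g)⁻¹ := by
      rw [← map_inv]; exact congrArg Subtype.val hq'
    simp only [hg, smul_mul_assoc, map_smul, ← map_mul, fixedProj_of]
    rw [Finset.sum_eq_single q]
    · rw [if_pos]
      · rw [← map_mul, mul_inv_cancel_right]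
      · rw [map_mul, hq, mul_inv_cancel]
    · intro r _ hr
      rw [if_neg, zero_mul, smul_zero]
      intro h
      apply hr
      apply (displacement_bijective_range hP hm hem).1
      apply (displacement_bijective_range hP hm hem).1
      apply Subtype.ext
      change e.displacement (e.displacement r) = e.displacement (e.displacement q)
      rw [hq, ← mul_eq_one_iff_eq_inv', ← map_mul, h]
    · simp

/-- As p divides |Q|, the sum equals Σ(q - 1), which modulo I² is the class of (∏q) - 1. Both e and
φ permute Q, so the product π satisfies π = φ(π) = e(π)π⁻¹ = 1. This argument also covers p = 2. -/
theorem sum_displacement_mem_augIdeal_sq [Finite P] {p : ℕ} [Fact p.Prime] [CharP k p]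
    (hP : IsPGroup p P) {e : MulAut P} {m : ℕ} (hm : m.Coprime p) (hem : e ^ m = 1)
    [Fintype e.displacement.range] (he : e ≠ 1) :
    ∑ q : e.displacement.range, of k P (q : P) ∈ augIdeal k P ^ 2 := by
  classical
  have hbij := displacement_bijective_range hP hm hem
  have hprod : ∏ q : e.displacement.range, (q : P) = 1 := by
    have h1 : e.displacement (∏ q : e.displacement.range, (q : P)) =
        ∏ q : e.displacement.range, (q : P) := by
      rw [map_prod]
      exact Fintype.prod_bijective _ hbij _ _ fun q => rfl
    have h2 : e (∏ q : e.displacement.range, (q : P)) = ∏ q : e.displacement.range, (q : P) := by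
      rw [map_prod]
      have hinj : Function.Injective (fun q : e.displacement.range =>
          (⟨e q, by
            rw [apply_eq_displacement_mul]
            exact mul_mem ⟨_, rfl⟩ q.2⟩ : e.displacement.range)) := fun a b h =>
        Subtype.ext (e.injective (congrArg Subtype.val h))
      exact Fintype.prod_bijective _ (Finite.injective_iff_bijective.1 hinj) _ _ fun q => rfl
    rw [← h1, displacement_apply, h2, mul_inv_cancel]
  have hcard : ((Fintype.card e.displacement.range : ℕ) : k) = 0 := by
    rw [CharP.cast_eq_zero_iff k p, Fintype.card_eq_nat_card]
    have hnt : Nontrivial e.displacement.range := by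
      rw [Subgroup.nontrivial_iff_exists_ne_one]
      by_contra! h
      apply he
      ext u
      rw [apply_eq_displacement_mul, h _ ⟨u, rfl⟩, one_mul, MulAut.one_apply]
    obtain ⟨n, hn, hc⟩ := (IsPGroup.nontrivial_iff_card (hP.to_subgroup _)).1 hnt
    rw [hc]
    exact dvd_pow_self p hn.ne'
  have : ∑ q : e.displacement.range, of k P (q : P) =
      ∑ q : e.displacement.range, (of k P (q : P) - 1) := by
    rw [Finset.sum_sub_distrib, Finset.sum_const, Finset.card_univ, ← Nat.cast_smul_eq_nsmul k,
      hcard, zero_smul, sub_zero]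
  rw [this, ← Ideal.Quotient.eq_zero_iff_mem, map_sum]
  have h3 : ∀ q : e.displacement.range, Ideal.Quotient.mk (augIdeal k P ^ 2) (of k P (q : P) - 1) =
    augClass k P (Additive.ofMul (q : P)) := fun q => rfl
  simp only [h3]
  rw [← map_sum, ← ofMul_prod, hprod, ofMul_one, map_zero]

/-- A derivation of the group algebra `k[P]`, twisted by a nontrivial automorphism `e` of order prime
to `p`, is inner modulo the square of the augmentation ideal. -/
theorem exists_twistedDerivation_sub_mem_sq [Finite P] {p : ℕ} [Fact p.Prime] [CharP k p]
    (hP : IsPGroup p P) {e : MulAut P} {m : ℕ} (hm : m.Coprime p) (hem : e ^ m = 1) (he : e ≠ 1)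
    (d : MonoidAlgebra k P →ₗ[k] MonoidAlgebra k P)
    (hd : ∀ x y, d (x * y) = d x * act k e y + x * d y) :
    ∃ x, ∀ u : P, d (of k P u) - x * (of k P (e u) - of k P u) ∈ augIdeal k P ^ 2 := by
  classical
  have := Fintype.ofFinite e.displacement.range
  have hinv : ∀ u : P, of k P u⁻¹ * of k P u = 1 := fun u => by
    rw [← map_mul, inv_mul_cancel, map_one]
  -- Dividing by u turns the twisted Leibniz rule into a crossed homomorphism rule. Commutativity of
  -- P then gives the symmetry `hsymm`.
  set f : P → MonoidAlgebra k P := fun u => of k P u⁻¹ * d (of k P u) with hf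
  have hdf : ∀ u, d (of k P u) = of k P u * f u := fun u => by
    rw [hf, ← mul_assoc, mul_comm (of k P u), hinv, one_mul]
  have hfmul : ∀ u v, f (u * v) = f u * of k P (e.displacement v) + f v := fun u v => by
    simp only [hf]
    rw [map_mul (of k P) u v, hd, act_of, mul_inv, map_mul, displacement_apply, map_mul]
    linear_combination (of k P v⁻¹ * d (of k P v)) * hinv u
  have hsymm : ∀ u v, f u * (of k P (e.displacement v) - 1) =
      f v * (of k P (e.displacement u) - 1) := fun u v => by
    have h1 := hfmul u v
    rw [mul_comm u v, hfmul v u] at h1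
    linear_combination -h1
  -- A solution of x(φ(r) - 1) = f(r) for every r in the image of φ: shifting the index by r and
  -- applying the rule for f gives back x plus the expansion of f(r) from `sum_fixedProj`.
  set x := ∑ q : e.displacement.range,
    fixedProj k e (f q) * of k P (e.displacement q)⁻¹ with hx
  have hxr : ∀ r : e.displacement.range, x * of k P (e.displacement r) = f r + x := by
    intro r
    have h1 : x = ∑ q : e.displacement.range,
        fixedProj k e (f (r * q)) * of k P (e.displacement (r * q))⁻¹ := by
      rw [hx]
      exact (Fintype.sum_equiv (Equiv.mulLeft r) _ _ fun q => rfl).symm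
    conv_lhs => rw [h1]
    rw [Finset.sum_mul]
    have h2 : ∀ q : e.displacement.range,
        fixedProj k e (f (r * q)) * of k P (e.displacement (r * q))⁻¹ * of k P (e.displacement r) =
        fixedProj k e (f r * of k P (e.displacement q)) * of k P (e.displacement q)⁻¹ +
        fixedProj k e (f q) * of k P (e.displacement q)⁻¹ := by
      intro q
      rw [mul_assoc, ← map_mul, map_mul e.displacement, mul_inv_rev, inv_mul_cancel_right, hfmul,
        map_add, add_mul]
    rw [Finset.sum_congr rfl fun q _ => h2 q, Finset.sum_add_distrib, sum_fixedProj hP hm hem]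
  -- For c fixed by e, symmetry gives f(c)φ(v) = f(c), so the expansion of f(c) is a multiple of the
  -- sum over the image of φ, which lies in I².
  have hfix : ∀ c, e.displacement c = 1 → f c ∈ augIdeal k P ^ 2 := by
    intro c hc
    have h1 : ∀ v, f c * of k P (e.displacement v) = f c := fun v => by
      have := hsymm c v
      rw [hc, map_one, sub_self, mul_zero] at this
      linear_combination this
    have h2 := sum_fixedProj hP hm hem (f c)
    simp only [h1] at h2
    rw [← Finset.mul_sum] at h2
    rw [← h2]
    apply Ideal.mul_mem_left
    have h3 := sum_displacement_mem_augIdeal_sq (k := k) hP hm hem he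
    rw [← Fintype.sum_bijective _ (displacement_bijective_range hP hm hem)
      (fun q => of k P (e.displacement q)) _ fun q => rfl,
      ← Fintype.sum_equiv (Equiv.inv _) (fun q : e.displacement.range =>
        of k P (e.displacement (q : P))⁻¹) _ fun q => by simp] at h3
    exact h3
  refine ⟨x, fun u => ?_⟩
  -- Split u = cr with r in the image of φ and c fixed by e. The element x accounts for r exactly,
  -- and c contributes only an error in I².
  obtain ⟨r, hr⟩ := (displacement_bijective_range hP hm hem).2 ⟨_, u, rfl⟩
  have hr' : e.displacement r = e.displacement u := congrArg Subtype.val hr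
  have hc : e.displacement (u * (r : P)⁻¹) = 1 := by
    rw [map_mul, map_inv, hr', mul_inv_cancel]
  have h1 := hfmul (u * (r : P)⁻¹) r
  rw [inv_mul_cancel_right] at h1
  have h2 : d (of k P u) - x * (of k P (e u) - of k P u) =
      of k P u * of k P (e.displacement r) * f (u * (r : P)⁻¹) := by
    rw [hdf, h1, apply_eq_displacement_mul, map_mul, ← hr']
    linear_combination -of k P u * hxr r
  rw [h2]
  exact Ideal.mul_mem_left _ _ (hfix _ hc)

end Projection

end MonoidAlgebra

/-! ### Equivariant derivations of k[P] modulo I² -/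

namespace MonoidAlgebra

section Derivations

variable {k : Type v} [Field k] {P : Type u} [CommGroup P]

/-- A derivation of `k[P]` commuting with a group `E` of automorphisms of `P` such that
`[P, E] = P` takes values in the augmentation ideal. -/
theorem derivation_mem_augIdeal {E : Subgroup (MulAut P)} (hPE : autCommutator E = ⊤)
    (d : MonoidAlgebra k P →ₗ[k] MonoidAlgebra k P)
    (hd : ∀ x y, d (x * y) = d x * y + x * d y)
    (hE : ∀ e ∈ E, ∀ x, d (act k e x) = act k e (d x)) (x : MonoidAlgebra k P) :
    d x ∈ augIdeal k P := by
  refine map_mem_of_forall_of d ((augIdeal k P).restrictScalars k) (fun u => ?_) x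
  set ε := lift k k P (1 : P →* k) with hε
  have hεof : ∀ u, ε (of k P u) = 1 := fun u => by simp [hε]
  have hεact : ∀ (e : MulAut P) x, ε (act k e x) = ε x := fun e x => by
    have h : ε.comp (act k e).toAlgHom = ε := by
      ext u
      simp [hε]
    exact DFunLike.congr_fun h x
  -- The augmentation is 1 on group elements, so it turns the Leibniz rule into additivity.
  -- Equivariance makes the resulting character E-invariant, hence trivial on [P, E].
  let χ : P →* Multiplicative k :=
    { toFun := fun u => Multiplicative.ofAdd (ε (d (of k P u)))
      map_one' := by
        have h := hd 1 1
        rw [mul_one, mul_one, one_mul, left_eq_add] at h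
        rw [map_one, h, map_zero, ofAdd_zero]
      map_mul' := fun u v => by
        rw [map_mul, hd, map_add, map_mul, map_mul, hεof, hεof, mul_one, one_mul, ofAdd_add] }
  have hker : autCommutator E ≤ χ.ker := by
    rw [autCommutator, Subgroup.closure_le]
    rintro _ ⟨e, he, u, rfl⟩
    change χ (e u * u⁻¹) = 1
    rw [map_mul, map_inv, mul_inv_eq_one]
    change Multiplicative.ofAdd (ε (d (of k P (e u)))) = Multiplicative.ofAdd (ε (d (of k P u)))
    rw [← act_of, hE e he, hεact]
  rw [hPE] at hker
  exact hker (Subgroup.mem_top u)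

theorem derivation_mem_augIdeal_sq (d : MonoidAlgebra k P →ₗ[k] MonoidAlgebra k P)
    (hd : ∀ x y, d (x * y) = d x * y + x * d y) (hI : ∀ x, d x ∈ augIdeal k P)
    {x : MonoidAlgebra k P} (hx : x ∈ augIdeal k P ^ 2) : d x ∈ augIdeal k P ^ 2 := by
  rw [pow_two] at hx
  induction hx using Submodule.mul_induction_on' with
  | mem_mul_mem y hy z hz =>
    rw [hd]
    exact add_mem (mem_augIdeal_sq_of_mul (hI y) hz) (mem_augIdeal_sq_of_mul hy (hI z))
  | add y _ z _ hy hz =>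
    rw [map_add]
    exact add_mem hy hz

theorem derivation_of_sub_one (d : MonoidAlgebra k P →ₗ[k] MonoidAlgebra k P)
    (hd : ∀ x y, d (x * y) = d x * y + x * d y) (x : MonoidAlgebra k P) : d (x - 1) = d x := by
  have h := hd 1 1
  rw [mul_one, mul_one, one_mul, left_eq_add] at h
  rw [map_sub, h, sub_zero]

/-- If `I / I²` is generated by a single element under the action of a commutative group `E` of
automorphisms, then `E`-equivariant derivations of `k[P]` with values in the augmentation ideal `I`
commute modulo `I²`. -/
theorem derivation_commutator_mem_sq {E : Subgroup (MulAut P)}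
    (hE : ∀ e ∈ E, ∀ f ∈ E, e * f = f * e) {w : P}
    (hw : ∀ N : Submodule k (MonoidAlgebra k P), (augIdeal k P ^ 2).restrictScalars k ≤ N →
      (∀ e ∈ E, of k P (e w) - 1 ∈ N) → (augIdeal k P).restrictScalars k ≤ N)
    (d d' : MonoidAlgebra k P →ₗ[k] MonoidAlgebra k P)
    (hd : ∀ x y, d (x * y) = d x * y + x * d y) (hd' : ∀ x y, d' (x * y) = d' x * y + x * d' y)
    (hdI : ∀ x, d x ∈ augIdeal k P) (hdI' : ∀ x, d' x ∈ augIdeal k P)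
    (hdE : ∀ e ∈ E, ∀ x, d (act k e x) = act k e (d x))
    (hdE' : ∀ e ∈ E, ∀ x, d' (act k e x) = act k e (d' x)) (x : MonoidAlgebra k P) :
    d (d' x) - d' (d x) ∈ augIdeal k P ^ 2 := by
  -- S is the image of kE in End(k[P]). Its elements commute with each other, as E is commutative,
  -- and with every equivariant map.
  set S : Submodule k (Module.End k (MonoidAlgebra k P)) :=
    Submodule.span k (Set.range fun e : E => (act k (e : MulAut P)).toLinearMap) with hS
  have hspan : ∀ y ∈ augIdeal k P, ∃ a ∈ S, y - a (of k P w - 1) ∈ augIdeal k P ^ 2 := by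
    intro y hy
    have := hw (S.map (LinearMap.applyₗ (of k P w - 1)) ⊔ (augIdeal k P ^ 2).restrictScalars k)
      le_sup_right (fun e he => Submodule.mem_sup_left
        ⟨_, Submodule.subset_span ⟨⟨e, he⟩, rfl⟩, by
          rw [LinearMap.applyₗ_apply_apply, AlgEquiv.toLinearMap_apply, map_sub, act_of,
            map_one]⟩) hy
    obtain ⟨_, ⟨a, ha, rfl⟩, z, hz, rfl⟩ := Submodule.mem_sup.1 this
    refine ⟨a, ha, ?_⟩
    rwa [LinearMap.applyₗ_apply_apply, add_sub_cancel_left]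
  have hcomm : ∀ g : Module.End k (MonoidAlgebra k P), (∀ e ∈ E, ∀ x, g (act k e x) = act k e (g x))
      → ∀ a ∈ S, ∀ x, g (a x) = a (g x) := by
    intro g hg a ha
    induction ha using Submodule.span_induction with
    | mem a ha =>
      obtain ⟨e, rfl⟩ := ha
      exact hg e e.2
    | zero => simp
    | add a b _ _ ha hb => intro x; simp only [LinearMap.add_apply, map_add, ha, hb]
    | smul c a _ ha => intro x; simp only [LinearMap.smul_apply, map_smul, ha]
  have hSS : ∀ a ∈ S, ∀ b ∈ S, ∀ x, a (b x) = b (a x) := by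
    intro a ha
    refine hcomm a fun e he x => ?_
    have := hcomm (act k e).toLinearMap (fun f hf x => ?_) a ha x
    · exact this.symm
    · change act k e (act k f x) = act k f (act k e x)
      rw [act_act, act_act, hE e he f hf]
  have hSsq : ∀ a ∈ S, ∀ x ∈ augIdeal k P ^ 2, a x ∈ augIdeal k P ^ 2 := by
    intro a ha x hx
    induction ha using Submodule.span_induction with
    | mem a ha =>
      obtain ⟨e, rfl⟩ := ha
      exact act_mem_augIdeal_pow _ hx
    | zero => simp
    | add a b _ _ ha hb => exact add_mem ha hb
    | smul c a _ ha => exact ((augIdeal k P ^ 2).restrictScalars k).smul_mem c ha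
  -- Modulo I², d and d' act on the generator w - 1 as the elements a and b of S, which commute.
  obtain ⟨a, ha, ha2⟩ := hspan _ (hdI (of k P w - 1))
  obtain ⟨b, hb, hb2⟩ := hspan _ (hdI' (of k P w - 1))
  set v := of k P w - 1 with hv
  set c : MonoidAlgebra k P →ₗ[k] MonoidAlgebra k P := d ∘ₗ d' - d' ∘ₗ d with hc
  have hcv : c v ∈ augIdeal k P ^ 2 := by
    have : c v = d (d' v - b v) + b (d v - a v) - (d' (d v - a v) + a (d' v - b v)) := by
      simp only [hc, LinearMap.sub_apply, LinearMap.comp_apply, map_sub, hcomm d hdE b hb,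
        hcomm d' hdE' a ha, hSS a ha b hb]
      abel
    rw [this]
    exact sub_mem (add_mem (derivation_mem_augIdeal_sq d hd hdI hb2) (hSsq b hb _ ha2))
      (add_mem (derivation_mem_augIdeal_sq d' hd' hdI' ha2) (hSsq a ha _ hb2))
  have hcE : ∀ e ∈ E, ∀ x, c (act k e x) = act k e (c x) := by
    intro e he x
    simp only [hc, LinearMap.sub_apply, LinearMap.comp_apply, hdE e he, hdE' e he, map_sub]
  -- The elements that c sends into I² form a subspace containing I² and all e(w) - 1, so it
  -- contains I.
  have hall := hw (((augIdeal k P ^ 2).restrictScalars k).comap c)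
    (fun x hx => by
      rw [Submodule.mem_comap, hc, LinearMap.sub_apply]
      exact sub_mem
        (derivation_mem_augIdeal_sq d hd hdI (derivation_mem_augIdeal_sq d' hd' hdI' hx))
        (derivation_mem_augIdeal_sq d' hd' hdI' (derivation_mem_augIdeal_sq d hd hdI hx)))
    (fun e he => by
      have : of k P (e w) - 1 = act k e v := by rw [hv, map_sub, act_of, map_one]
      rw [this, Submodule.mem_comap, hcE e he]
      exact act_mem_augIdeal_pow e hcv)
  refine map_mem_of_forall_of c ((augIdeal k P ^ 2).restrictScalars k) (fun u => ?_) x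
  have h := hall (of_sub_one_mem_augIdeal u)
  rw [Submodule.mem_comap] at h
  have hcu : c (of k P u - 1) = c (of k P u) := by
    simp only [hc, LinearMap.sub_apply, LinearMap.comp_apply, derivation_of_sub_one d hd,
      derivation_of_sub_one d' hd']
  rwa [hcu] at h

end Derivations

/-! ### Comparison of I/I² with P/Φ(P) -/

section Frattini

variable {k : Type v} [Field k] {P : Type u} [CommGroup P] {p : ℕ}

open FrattiniQuotient in
theorem _root_.FrattiniQuotient.mk_eq_zero_iff (hP : IsPGroup p P) (u : P) :
    mk hP u = 0 ↔ u ∈ frattini P :=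
  QuotientGroup.eq_one_iff u

theorem _root_.FrattiniQuotient.mk_mul (hP : IsPGroup p P) (u v : P) :
    FrattiniQuotient.mk hP (u * v) = FrattiniQuotient.mk hP u + FrattiniQuotient.mk hP v := rfl

/-- The Frattini subgroup is killed by all characters with values in `𝔽_p`. -/
theorem _root_.AddMonoidHom.map_frattini_eq_zero [Fact p.Prime] (χ : Additive P →+ ZMod p) {u : P}
    (hu : u ∈ frattini P) : χ (Additive.ofMul u) = 0 := by
  by_contra hne
  set M : Subgroup P := (AddMonoidHom.toMultiplicativeRight χ).ker with hM
  have hMmem : ∀ w, w ∈ M ↔ χ (Additive.ofMul w) = 0 := fun w => Iff.rfl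
  have hco : IsCoatom M := by
    refine ⟨fun h => hne ((hMmem u).1 (h ▸ Subgroup.mem_top u)), fun H hH => ?_⟩
    obtain ⟨h, hhH, hhM⟩ := SetLike.exists_of_lt hH
    rw [hMmem] at hhM
    rw [eq_top_iff]
    intro w _
    -- The ratio of the two values of χ, so that w and hⁿ agree modulo ker χ. This shows that ker χ
    -- and any h outside it generate P.
    set n := (χ (Additive.ofMul w) / χ (Additive.ofMul h)).val with hn
    have hw : w * (h ^ n)⁻¹ ∈ M := by
      rw [hMmem, ofMul_mul, ofMul_inv, ofMul_pow, map_add, map_neg, map_nsmul, nsmul_eq_mul, hn,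
        ZMod.natCast_val, ZMod.cast_id, div_mul_cancel₀ _ hhM, add_neg_cancel]
    have := H.mul_mem (hH.le hw) (H.pow_mem hhH n)
    rwa [inv_mul_cancel_right] at this
  exact hne ((hMmem u).1 (frattini_le_coatom hco hu))

theorem _root_.AddMonoidHom.map_frattini_eq_zero_of_module [Fact p.Prime] {W : Type*}
    [AddCommGroup W] [Module (ZMod p) W] (f : Additive P →+ W) {u : P}
    (hu : u ∈ frattini P) : f (Additive.ofMul u) = 0 := by
  rw [← Module.forall_dual_apply_eq_zero_iff (ZMod p)]
  intro φ
  exact AddMonoidHom.map_frattini_eq_zero (φ.toAddMonoidHom.comp f) hu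

/-- An 𝔽_p-character of P/Φ(P) extends k-linearly to k[P] and kills every (a - 1)(b - 1), hence I²;
such characters separate the points of P/Φ(P). Conversely, u ↦ u - 1 is a homomorphism to the
𝔽_p-space k[P]/I², so it kills Φ(P). -/
theorem of_sub_one_mem_augIdeal_sq_iff [Fact p.Prime] [CharP k p] (hP : IsPGroup p P) (u : P) :
    of k P u - 1 ∈ augIdeal k P ^ 2 ↔ u ∈ frattini P := by
  constructor
  · intro hu
    rw [← FrattiniQuotient.mk_eq_zero_iff hP, ← Module.forall_dual_apply_eq_zero_iff (ZMod p)]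
    intro φ
    set χ : P → k := fun w => ZMod.castHom dvd_rfl k (φ (FrattiniQuotient.mk hP w)) with hχ
    have hχmul : ∀ a b, χ (a * b) = χ a + χ b := fun a b => by
      simp only [hχ, FrattiniQuotient.mk_mul, map_add]
    obtain ⟨l, hlof⟩ : ∃ l : MonoidAlgebra k P →ₗ[k] k, ∀ a, l (of k P a) = χ a :=
      ⟨Finsupp.linearCombination k χ ∘ₗ (coeffLinearEquiv k).toLinearMap, fun a => by simp⟩
    have hχ1 : χ 1 = 0 := by
      have := hχmul 1 1
      rwa [mul_one, left_eq_add] at this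
    have hl2 : ∀ x ∈ augIdeal k P ^ 2, l x = 0 := by
      intro x hx
      rw [pow_two] at hx
      induction hx using Submodule.mul_induction_on' with
      | mem_mul_mem y hy z hz =>
        have h := map_augIdeal_mem (l ∘ₗ LinearMap.mulRight k z) ⊥ (fun a => ?_) hy
        · rwa [Submodule.mem_bot, LinearMap.comp_apply, LinearMap.mulRight_apply] at h
        rw [LinearMap.comp_apply, LinearMap.mulRight_apply]
        have h := map_augIdeal_mem (l ∘ₗ LinearMap.mulLeft k (of k P a - 1)) ⊥ (fun b => ?_) hz
        · rwa [LinearMap.comp_apply, LinearMap.mulLeft_apply] at h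
        rw [Submodule.mem_bot, LinearMap.comp_apply, LinearMap.mulLeft_apply]
        have : (of k P a - 1) * (of k P b - 1) = of k P (a * b) - of k P a - of k P b + of k P 1 := by
          rw [map_mul, map_one]; ring
        rw [this, map_add, map_sub, map_sub, hlof, hlof, hlof, hlof, hχmul, hχ1]
        ring
      | add y _ z _ hy hz => rw [map_add, hy, hz, add_zero]
    have h := hl2 _ hu
    rw [← map_one (of k P), map_sub, hlof, hlof, hχ1, sub_zero] at h
    exact (map_eq_zero (ZMod.castHom dvd_rfl k)).1 h
  · intro hu
    have hpQ : ∀ x : MonoidAlgebra k P ⧸ augIdeal k P ^ 2, p • x = 0 := by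
      intro x
      rw [← Nat.cast_smul_eq_nsmul k, CharP.cast_eq_zero, zero_smul]
    rw [← augClass_eq_zero_iff]
    let _ : Module (ZMod p) (MonoidAlgebra k P ⧸ augIdeal k P ^ 2) := AddCommGroup.zmodModule hpQ
    exact AddMonoidHom.map_frattini_eq_zero_of_module (p := p) (augClass k P) hu

/-- If `w` generates `P / Φ(P)` as an `𝔽_p E`-module, then the elements `e(w) - 1` span
`I / I²`. -/
theorem augIdeal_le_of_span_eq_top [Fact p.Prime] [CharP k p] (hP : IsPGroup p P)
    (E : Subgroup (MulAut P)) {w : P}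
    (hw : Submodule.span (MonoidAlgebra (ZMod p) E)
      {((FrattiniQuotient.representation hP E).asModuleEquiv.symm (FrattiniQuotient.mk hP w))} = ⊤)
    (N : Submodule k (MonoidAlgebra k P)) (hN : (augIdeal k P ^ 2).restrictScalars k ≤ N)
    (hwN : ∀ e ∈ E, of k P (e w) - 1 ∈ N) : (augIdeal k P).restrictScalars k ≤ N := by
  have hmul : ∀ a b, of k P a - 1 ∈ N → of k P b - 1 ∈ N → of k P (a * b) - 1 ∈ N := by
    intro a b ha hb
    have := N.add_mem (hN (of_mul_sub_one_congr (k := k) a b)) (N.add_mem ha hb)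
    rwa [sub_add_cancel] at this
  have hpow : ∀ a, of k P a - 1 ∈ N → ∀ n : ℕ, of k P (a ^ n) - 1 ∈ N := by
    intro a ha n
    induction n with
    | zero => rw [pow_zero, map_one, sub_self]; exact N.zero_mem
    | succ n ih => rw [pow_succ]; exact hmul _ _ ih ha
  set ρ := FrattiniQuotient.representation hP E with hρ
  have hr : ∀ r : MonoidAlgebra (ZMod p) E, ∃ a : P, of k P a - 1 ∈ N ∧
      FrattiniQuotient.mk hP a = ρ.asAlgebraHom r (FrattiniQuotient.mk hP w) := by
    intro r
    induction r using induction_linear with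
    | zero => exact ⟨1, by rw [map_one, sub_self]; exact N.zero_mem, by rw [map_zero]; rfl⟩
    | add r s hr hs =>
      obtain ⟨a, ha, ha'⟩ := hr
      obtain ⟨b, hb, hb'⟩ := hs
      exact ⟨a * b, hmul a b ha hb, by
        rw [FrattiniQuotient.mk_mul, ha', hb', map_add, LinearMap.add_apply]⟩
    | single e n =>
      refine ⟨(e : MulAut P) w ^ n.val, hpow _ (hwN e e.2) _, ?_⟩
      rw [Representation.asAlgebraHom_single, LinearMap.smul_apply]
      conv_rhs => rw [← ZMod.natCast_zmod_val n, Nat.cast_smul_eq_nsmul]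
      rfl
  intro x hx
  refine map_augIdeal_mem LinearMap.id N (fun u => ?_) hx
  have hu : ρ.asModuleEquiv.symm (FrattiniQuotient.mk hP u) ∈
      Submodule.span (MonoidAlgebra (ZMod p) E)
        {ρ.asModuleEquiv.symm (FrattiniQuotient.mk hP w)} := hw ▸ Submodule.mem_top
  obtain ⟨r, hr'⟩ := Submodule.mem_span_singleton.1 hu
  have hr2 := congrArg ρ.asModuleEquiv hr'
  rw [Representation.asModuleEquiv_map_smul, LinearEquiv.apply_symm_apply,
    LinearEquiv.apply_symm_apply] at hr2
  obtain ⟨a, ha, ha'⟩ := hr r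
  rw [hr2] at ha'
  have hfr : a⁻¹ * u ∈ frattini P := QuotientGroup.eq.1 ha'
  have := hmul _ _ ha (hN ((of_sub_one_mem_augIdeal_sq_iff hP _).2 hfr))
  rwa [mul_inv_cancel_left] at this

end Frattini

end MonoidAlgebra

/-! ### Multiplicity free modules: cyclicity and 𝔰𝔩₂-triples -/

/-- A finite multiplicity free module over a ring with commutative multiplication is cyclic. -/
theorem IsMultiplicityFree.exists_span_singleton_eq_top {R : Type*} [Ring R]
    (hR : ∀ a b : R, a * b = b * a) {M : Type*} [AddCommGroup M] [Module R M] [Finite M]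
    (h : IsMultiplicityFree R M) : ∃ x : M, Submodule.span R {x} = ⊤ := by
  classical
  let _ : CommRing R := { ‹Ring R› with mul_comm := hR }
  obtain ⟨𝒮, hsimple, -, htop, hne⟩ := h
  have : Fintype 𝒮 := Fintype.ofFinite _
  have hS : ∀ S : 𝒮, IsSimpleModule R (S : Submodule R M) := fun S => hsimple S S.2
  choose x hx using fun S : 𝒮 => have := (hS S).nontrivial; exists_ne (0 : S.1)
  let 𝔪 : 𝒮 → Ideal R := fun S => LinearMap.ker (LinearMap.toSpanSingleton R S.1 (x S))
  have hmax : ∀ S, (𝔪 S).IsMaximal := fun S =>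
    have := hS S
    IsSimpleModule.ker_toSpanSingleton_isMaximal R (hx S)
  have hequiv : ∀ S, Nonempty ((R ⧸ 𝔪 S) ≃ₗ[R] S.1) := fun S =>
    have := hS S
    ⟨LinearMap.quotKerEquivOfSurjective _ (IsSimpleModule.toSpanSingleton_surjective R (hx S))⟩
  -- Each summand is R/𝔪, so two equal annihilators would give isomorphic summands. Distinct maximal
  -- ideals are coprime.
  have hcop : Pairwise (Function.onFun IsCoprime 𝔪) := by
    intro S T hST
    have := hmax S
    have := hmax T
    refine Ideal.isCoprime_of_isMaximal fun hmm => ?_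
    obtain ⟨φ⟩ := hequiv S
    obtain ⟨ψ⟩ := hequiv T
    exact (hne S.2 T.2 (fun h => hST (Subtype.ext h))).false
      (φ.symm.trans ((Submodule.quotEquivOfEq _ _ hmm).trans ψ))
  -- The sum of the chosen generators generates M: the Chinese remainder theorem gives a scalar that
  -- is 1 on one summand and 0 on the others.
  refine ⟨∑ S, (x S : M), ?_⟩
  rw [eq_top_iff, ← htop, sSup_le_iff]
  intro S hS'
  obtain ⟨r, hr⟩ := Ideal.exists_forall_sub_mem_ideal hcop (Pi.single (⟨S, hS'⟩ : 𝒮) (1 : R))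
  have hrx : r • ∑ T, (x T : M) = x ⟨S, hS'⟩ := by
    rw [Finset.smul_sum, Finset.sum_eq_single ⟨S, hS'⟩]
    · have h1 := hr ⟨S, hS'⟩
      rw [LinearMap.mem_ker, LinearMap.toSpanSingleton_apply, Pi.single_eq_same, sub_smul,
        one_smul, sub_eq_zero] at h1
      exact congrArg Subtype.val h1
    · intro T _ hT
      have h1 := hr T
      rw [LinearMap.mem_ker, LinearMap.toSpanSingleton_apply, Pi.single_eq_of_ne hT,
        sub_zero] at h1
      exact congrArg Subtype.val h1
    · simp
  intro y hy
  have := hS ⟨S, hS'⟩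
  obtain ⟨s, hs⟩ := IsSimpleModule.toSpanSingleton_surjective R (hx ⟨S, hS'⟩) ⟨y, hy⟩
  have hs' : s • (x ⟨S, hS'⟩ : M) = y := congrArg Subtype.val hs
  exact Submodule.mem_span_singleton.2 ⟨s * r, by rw [mul_smul, hrx, hs']⟩

/-- The endomorphism ring of a semisimple module which is not multiplicity free contains an
`𝔰𝔩₂`-triple. -/
theorem exists_sl2_of_not_isMultiplicityFree {R : Type*} [Ring R] {M : Type*} [AddCommGroup M]
    [Module R M] [IsSemisimpleModule R M] (h : ¬ IsMultiplicityFree R M) :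
    ∃ e f h : Module.End R M, e ≠ 0 ∧ e * f - f * e = h ∧ h * e - e * h = e + e ∧
      h * f - f * h = -(f + f) := by
  obtain ⟨𝒮, hind, htop, hsimple⟩ := IsSemisimpleModule.exists_sSupIndep_sSup_simples_eq_top R M
  have hnot : ¬ 𝒮.Pairwise fun S T => IsEmpty (S ≃ₗ[R] T) := fun hp =>
    h ⟨𝒮, hsimple, hind, htop, hp⟩
  simp only [Set.Pairwise, not_forall, not_isEmpty_iff] at hnot
  obtain ⟨S, hS, T, hT, hST, ⟨φ⟩⟩ := hnot
  have hcompl : ∀ U ∈ 𝒮, IsCompl U (sSup (𝒮 \ {U})) := by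
    intro U hU
    refine ⟨hind hU, codisjoint_iff_le_sup.2 ?_⟩
    rw [← htop, sSup_le_iff]
    intro V hV
    by_cases hVU : V = U
    · exact hVU ▸ le_sup_left
    · exact le_sup_of_le_right (le_sSup ⟨hV, hVU⟩)
  set πS := S.projectionOnto _ (hcompl S hS) with hπS
  set πT := T.projectionOnto _ (hcompl T hT) with hπT
  have hSS : ∀ x : S, πS x = x := Submodule.projectionOnto_apply_left _
  have hTT : ∀ x : T, πT x = x := Submodule.projectionOnto_apply_left _
  have hST0 : ∀ x : T, πS x = 0 := fun x => (Submodule.projectionOnto_apply_eq_zero_iff _).2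
    ((le_sSup (show T ∈ 𝒮 \ {S} from ⟨hT, fun h => hST h.symm⟩) : T ≤ _) x.2)
  have hTS0 : ∀ x : S, πT x = 0 := fun x => (Submodule.projectionOnto_apply_eq_zero_iff _).2
    ((le_sSup (show S ∈ 𝒮 \ {T} from ⟨hS, hST⟩) : S ≤ _) x.2)
  -- On S ⊕ T, with T identified with S by φ, these are the matrix units E₁₂, E₂₁ and diag(1, -1),
  -- extended by zero to the other summands.
  refine ⟨S.subtype ∘ₗ φ.symm.toLinearMap ∘ₗ πT, T.subtype ∘ₗ φ.toLinearMap ∘ₗ πS,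
    S.subtype ∘ₗ πS - T.subtype ∘ₗ πT, ?_, ?_, ?_, ?_⟩
  · intro h0
    have := (hsimple S hS).nontrivial
    obtain ⟨x, hx⟩ := exists_ne (0 : S)
    have h1 := LinearMap.congr_fun h0 (φ x : M)
    simp only [LinearMap.comp_apply, hTT, LinearEquiv.coe_coe, LinearEquiv.symm_apply_apply,
      Submodule.subtype_apply, LinearMap.zero_apply, ZeroMemClass.coe_eq_zero] at h1
    exact hx h1
  all_goals
    ext x
    simp only [LinearMap.sub_apply, LinearMap.add_apply, LinearMap.neg_apply, Module.End.mul_apply,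
      LinearMap.comp_apply, Submodule.subtype_apply, LinearEquiv.coe_coe, map_sub, hSS, hTT, hST0,
      hTS0, map_zero, LinearEquiv.symm_apply_apply,
      LinearEquiv.apply_symm_apply]
    try abel

/-! ### The crossed algebra A = ⊕ k[P]ê and its components -/

/-- The twisted group algebra of `P ⋊ E` for a cocycle inflated from `E`. -/
abbrev CrossedAlgebra {k : Type v} [Field k] {P : Type u} [CommGroup P] {E : Subgroup (MulAut P)}
    (α : TwoCocycle E k) : Type (max u v) :=
  TwistedGroupAlgebra (α.inflate (SemidirectProduct.rightHom : P ⋊[E.subtype] E →* E))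

namespace TwoCocycle

variable {G : Type*} [Group G] {k : Type*} [Field k] (α : TwoCocycle G k)

theorem one_left (x : G) : α.toFun 1 x = α.toFun 1 1 := by
  have h := α.cocycle 1 1 x
  rw [one_mul, one_mul, mul_left_inj] at h
  exact h.symm

theorem one_right (x : G) : α.toFun x 1 = α.toFun 1 1 := by
  have h := α.cocycle x 1 1
  rwa [mul_one, mul_one, mul_left_inj] at h

/-- The normalisation of a cocycle. -/
def normalized (x y : G) : kˣ := (α.toFun 1 1)⁻¹ * α.toFun x y

theorem normalized_one_left (x : G) : α.normalized 1 x = 1 := by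
  rw [normalized, one_left α x, inv_mul_cancel]

theorem normalized_one_right (x : G) : α.normalized x 1 = 1 := by
  rw [normalized, one_right α x, inv_mul_cancel]

end TwoCocycle

namespace CrossedAlgebra

open MonoidAlgebra

variable {k : Type v} [Field k] {P : Type u} [CommGroup P] {E : Subgroup (MulAut P)}
  (α : TwoCocycle E k)

/-- The basis element of the crossed algebra indexed by `(u, e)`, multiplied by `r` and normalised
so that `basis 1 1 1 = 1`. -/
noncomputable def basis (u : P) (e : E) (r : k) : CrossedAlgebra α :=
  TwistedGroupAlgebra.single _ ⟨u, e⟩ (r * ((α.toFun 1 1)⁻¹ : kˣ))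

variable {α}

theorem basis_mul_basis (u v : P) (e f : E) (r s : k) :
    basis α u e r * basis α v f s =
      basis α (u * (e : MulAut P) v) (e * f) (r * s * α.normalized e f) := by
  rw [basis, basis, TwistedGroupAlgebra.single_mul_single, basis]
  congr 1
  simp only [TwoCocycle.inflate, TwoCocycle.normalized, Units.val_mul]
  change _ * _ * (α.toFun e f : k) = _
  ring

theorem one_eq_basis : (1 : CrossedAlgebra α) = basis α 1 1 1 := by
  rw [TwistedGroupAlgebra.one_def, basis, one_mul]
  congr 2

theorem smul_basis (u : P) (e : E) (r s : k) : r • basis α u e s = basis α u e (r * s) := by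
  rw [basis, TwistedGroupAlgebra.smul_single, basis, mul_assoc]

theorem basis_induction {motive : CrossedAlgebra α → Prop} (a : CrossedAlgebra α)
    (zero : motive 0) (add : ∀ a b, motive a → motive b → motive (a + b))
    (basis : ∀ u e r, motive (basis α u e r)) : motive a := by
  induction a using TwistedGroupAlgebra.induction with
  | zero => exact zero
  | add a b ha hb => exact add a b ha hb
  | single g r =>
    have : TwistedGroupAlgebra.single _ g r =
        CrossedAlgebra.basis α g.left g.right (r * α.toFun 1 1) := by
      rw [CrossedAlgebra.basis, mul_assoc, Units.mul_inv, mul_one]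
    rw [this]
    exact basis _ _ _

variable (α) in
/-- The inclusion of the group algebra of `P` in the crossed algebra. -/
noncomputable def incl : MonoidAlgebra k P →ₐ[k] CrossedAlgebra α :=
  MonoidAlgebra.lift k (CrossedAlgebra α) P
    { toFun := fun u => basis α u 1 1
      map_one' := one_eq_basis.symm
      map_mul' := fun u v => by
        rw [basis_mul_basis, TwoCocycle.normalized_one_left, Units.val_one, mul_one, mul_one,
          mul_one, OneMemClass.coe_one, MulAut.one_apply] }

theorem incl_of (u : P) : incl α (of k P u) = basis α u 1 1 := by
  rw [incl, lift_of]; rfl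

variable (α) in
/-- The normalised basis element of the crossed algebra indexed by `e ∈ E`. -/
noncomputable def gen (e : E) : CrossedAlgebra α := basis α 1 e 1

theorem gen_one : gen α 1 = 1 := one_eq_basis.symm

theorem gen_mul_gen (e f : E) : gen α e * gen α f = (α.normalized e f : k) • gen α (e * f) := by
  rw [gen, gen, gen, basis_mul_basis, smul_basis, map_one, mul_one, mul_one, one_mul, mul_one]

theorem incl_of_mul_basis (u v : P) (e : E) (r : k) :
    incl α (of k P u) * basis α v e r = basis α (u * v) e r := by
  rw [incl_of, basis_mul_basis, TwoCocycle.normalized_one_left, one_mul, one_mul, Units.val_one,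
    mul_one, OneMemClass.coe_one, MulAut.one_apply]

theorem basis_mul_incl_of (u v : P) (e : E) (r : k) :
    basis α v e r * incl α (of k P u) = basis α (v * (e : MulAut P) u) e r := by
  rw [incl_of, basis_mul_basis, TwoCocycle.normalized_one_right, mul_one, mul_one, Units.val_one,
    mul_one]

theorem basis_eq (u : P) (e : E) (r : k) :
    basis α u e r = r • (incl α (of k P u) * gen α e) := by
  rw [gen, incl_of_mul_basis, smul_basis, mul_one, mul_one]

theorem gen_mul_incl (e : E) (x : MonoidAlgebra k P) :
    gen α e * incl α x = incl α (act k (e : MulAut P) x) * gen α e := by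
  induction x using induction_linear with
  | zero => simp
  | add x y hx hy => simp only [map_add, mul_add, add_mul, hx, hy]
  | single u r =>
    have : single u r = r • of k P u := by simp
    rw [this, map_smul, map_smul, map_smul, mul_smul_comm, smul_mul_assoc, act_of, gen,
      basis_mul_incl_of, incl_of_mul_basis, one_mul, mul_one]

open Classical in
variable (α) in
/-- The coefficient in `k[P]` of an element of the crossed algebra at `e ∈ E`. -/
noncomputable def cmp (e : E) : CrossedAlgebra α →ₗ[k] MonoidAlgebra k P :=
  Finsupp.linearCombination k (fun g : P ⋊[E.subtype] E =>
    if g.right = e then (α.toFun 1 1 : k) • of k P g.left else 0)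

open Classical in
theorem cmp_basis (e f : E) (u : P) (r : k) :
    cmp α e (basis α u f r) = if f = e then r • of k P u else 0 := by
  have h : cmp α e (basis α u f r) = (r * ((α.toFun 1 1)⁻¹ : kˣ)) •
      (if f = e then (α.toFun 1 1 : k) • of k P u else 0) :=
    Finsupp.linearCombination_single k _ _
  rw [h]
  split_ifs
  · rw [smul_smul, mul_assoc, Units.inv_mul, mul_one]
  · rw [smul_zero]

theorem cmp_basis_self (e : E) (u : P) (r : k) : cmp α e (basis α u e r) = r • of k P u := by
  rw [cmp_basis, if_pos rfl]

theorem cmp_basis_of_ne {e f : E} (h : f ≠ e) (u : P) (r : k) : cmp α e (basis α u f r) = 0 := by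
  rw [cmp_basis, if_neg h]

theorem sum_incl_cmp_mul_gen [Fintype E] (a : CrossedAlgebra α) :
    ∑ e : E, incl α (cmp α e a) * gen α e = a := by
  induction a using basis_induction with
  | zero => simp
  | add a b ha hb => simp only [map_add, add_mul, Finset.sum_add_distrib, ha, hb]
  | basis u e r =>
    rw [Finset.sum_eq_single e]
    · rw [cmp_basis_self, map_smul, smul_mul_assoc, basis_eq]
    · intro f _ hf
      rw [cmp_basis_of_ne hf.symm, map_zero, zero_mul]
    · simp

theorem cmp_incl_mul (e : E) (x : MonoidAlgebra k P) (a : CrossedAlgebra α) :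
    cmp α e (incl α x * a) = x * cmp α e a := by
  induction a using basis_induction with
  | zero => simp
  | add a b ha hb => simp only [map_add, mul_add, ha, hb]
  | basis u f r =>
    induction x using induction_linear with
    | zero => simp
    | add x y hx hy => simp only [map_add, add_mul, hx, hy]
    | single v s =>
      have : single v s = s • of k P v := by simp
      rw [this, map_smul, smul_mul_assoc, map_smul, incl_of_mul_basis, smul_mul_assoc]
      congr 1
      by_cases h : f = e
      · subst h
        rw [cmp_basis_self, cmp_basis_self, map_mul, mul_smul_comm]
      · rw [cmp_basis_of_ne h, cmp_basis_of_ne h, mul_zero]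

theorem cmp_mul_incl (e : E) (x : MonoidAlgebra k P) (a : CrossedAlgebra α) :
    cmp α e (a * incl α x) = cmp α e a * act k (e : MulAut P) x := by
  induction a using basis_induction with
  | zero => simp
  | add a b ha hb => simp only [map_add, add_mul, ha, hb]
  | basis u f r =>
    induction x using induction_linear with
    | zero => simp
    | add x y hx hy => simp only [map_add, mul_add, hx, hy]
    | single v s =>
      have : single v s = s • of k P v := by simp
      rw [this, map_smul, mul_smul_comm, map_smul, basis_mul_incl_of, map_smul, mul_smul_comm]
      congr 1
      by_cases h : f = e
      · subst h
        rw [cmp_basis_self, cmp_basis_self, act_of, map_mul, smul_mul_assoc]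
      · rw [cmp_basis_of_ne h, cmp_basis_of_ne h, zero_mul]

theorem cmp_gen_mul (f e : E) (a : CrossedAlgebra α) :
    cmp α (f * e) (gen α f * a) = (α.normalized f e : k) • act k (f : MulAut P) (cmp α e a) := by
  induction a using basis_induction with
  | zero => simp
  | add a b ha hb => simp only [map_add, mul_add, ha, hb, smul_add]
  | basis u g r =>
    rw [gen, basis_mul_basis, one_mul, one_mul]
    by_cases h : g = e
    · subst h
      rw [cmp_basis_self, cmp_basis_self, map_smul, act_of, smul_smul, mul_comm]
    · rw [cmp_basis_of_ne h, cmp_basis_of_ne (fun h' => h (mul_left_cancel h')), map_zero,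
        smul_zero]

theorem cmp_mul_gen (f e : E) (a : CrossedAlgebra α) :
    cmp α (e * f) (a * gen α f) = (α.normalized e f : k) • cmp α e a := by
  induction a using basis_induction with
  | zero => simp
  | add a b ha hb => simp only [map_add, add_mul, ha, hb, smul_add]
  | basis u g r =>
    rw [gen, basis_mul_basis, map_one, mul_one, mul_one]
    by_cases h : g = e
    · subst h
      rw [cmp_basis_self, cmp_basis_self, smul_smul, mul_comm]
    · rw [cmp_basis_of_ne h, cmp_basis_of_ne (fun h' => h (mul_right_cancel h')), smul_zero]

theorem cmp_gen_of_ne {e f : E} (h : f ≠ e) : cmp α e (gen α f) = 0 := cmp_basis_of_ne h _ _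

theorem cmp_gen_self (e : E) : cmp α e (gen α e) = 1 := by
  rw [gen, cmp_basis_self, one_smul, map_one]

theorem cmp_incl_one (x : MonoidAlgebra k P) : cmp α 1 (incl α x) = x := by
  rw [← mul_one (incl α x), cmp_incl_mul, ← gen_one, cmp_gen_self, mul_one]

theorem cmp_incl_of_ne {e : E} (he : e ≠ 1) (x : MonoidAlgebra k P) : cmp α e (incl α x) = 0 := by
  rw [← mul_one (incl α x), cmp_incl_mul, ← gen_one, cmp_gen_of_ne he.symm, mul_zero]

theorem gen_isUnit (e : E) : IsUnit (gen α e) := by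
  have h : ∀ e : E, ∃ b, gen α e * b = 1 := fun e =>
    ⟨(((α.normalized e e⁻¹)⁻¹ : kˣ) : k) • gen α e⁻¹, by
      rw [mul_smul_comm, gen_mul_gen, smul_smul, Units.inv_mul, one_smul, mul_inv_cancel, gen_one]⟩
  have h' : ∃ b, b * gen α e = 1 :=
    ⟨(((α.normalized e⁻¹ e)⁻¹ : kˣ) : k) • gen α e⁻¹, by
      rw [smul_mul_assoc, gen_mul_gen, smul_smul, Units.inv_mul, one_smul, inv_mul_cancel, gen_one]⟩
  obtain ⟨b, hb⟩ := h e
  obtain ⟨b', hb'⟩ := h'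
  exact isUnit_iff_exists_and_exists.2 ⟨⟨b, hb⟩, ⟨b', hb'⟩⟩

/-! ### The filtration by powers of the augmentation ideal -/

variable (α) in
/-- The elements of the crossed algebra with coefficients in the `n`-th power of the augmentation
ideal of `k[P]`. -/
noncomputable def filt (n : ℕ) : Submodule k (CrossedAlgebra α) :=
  ⨅ e : E, ((augIdeal k P ^ n).restrictScalars k).comap (cmp α e)

theorem mem_filt {n : ℕ} {a : CrossedAlgebra α} :
    a ∈ filt α n ↔ ∀ e, cmp α e a ∈ augIdeal k P ^ n := by
  simp [filt]

theorem mem_filt_zero (a : CrossedAlgebra α) : a ∈ filt α 0 := by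
  simp [mem_filt]

theorem filt_le (n : ℕ) : filt α (n + 1) ≤ filt α n := fun _ ha =>
  mem_filt.2 fun e => augIdeal_pow_le n (mem_filt.1 ha e)

theorem incl_mem_filt {n : ℕ} {x : MonoidAlgebra k P} (hx : x ∈ augIdeal k P ^ n) :
    incl α x ∈ filt α n := by
  refine mem_filt.2 fun e => ?_
  by_cases he : e = 1
  · rwa [he, cmp_incl_one]
  · rw [cmp_incl_of_ne he]
    exact zero_mem _

theorem mul_incl_mem_filt {m n : ℕ} {a : CrossedAlgebra α} (ha : a ∈ filt α m)
    {x : MonoidAlgebra k P} (hx : x ∈ augIdeal k P ^ n) : a * incl α x ∈ filt α (m + n) := by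
  refine mem_filt.2 fun e => ?_
  rw [cmp_mul_incl, pow_add]
  exact Ideal.mul_mem_mul (mem_filt.1 ha e) (act_mem_augIdeal_pow _ hx)

theorem mul_gen_mem_filt {n : ℕ} {a : CrossedAlgebra α} (ha : a ∈ filt α n) (f : E) :
    a * gen α f ∈ filt α n := by
  refine mem_filt.2 fun e => ?_
  rw [← inv_mul_cancel_right e f, cmp_mul_gen]
  exact ((augIdeal k P ^ n).restrictScalars k).smul_mem _ (mem_filt.1 ha _)

/-- Moving ê past k[P] applies e to the coefficients, and each Iⁿ is stable under E. -/
theorem mul_mem_filt [Finite E] {m n : ℕ} {a b : CrossedAlgebra α} (ha : a ∈ filt α m)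
    (hb : b ∈ filt α n) : a * b ∈ filt α (m + n) := by
  have := Fintype.ofFinite E
  rw [← sum_incl_cmp_mul_gen b, Finset.mul_sum]
  refine Submodule.sum_mem _ fun e _ => ?_
  rw [← mul_assoc]
  exact mul_gen_mem_filt (mul_incl_mem_filt ha (mem_filt.1 hb e)) e

theorem eq_zero_of_mem_filt [Finite E] {n : ℕ} (hn : augIdeal k P ^ n = ⊥) {a : CrossedAlgebra α}
    (ha : a ∈ filt α n) : a = 0 := by
  have := Fintype.ofFinite E
  rw [← sum_incl_cmp_mul_gen a]
  refine Finset.sum_eq_zero fun e _ => ?_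
  have h := mem_filt.1 ha e
  rw [hn, Ideal.mem_bot] at h
  rw [h, map_zero, zero_mul]

/-- For every y the product ya lies in IA, whose powers reach zero, so 1 + ya is a unit. -/
theorem mem_jacobson_of_mem_filt [Finite E] {n : ℕ} (hn : augIdeal k P ^ n = ⊥)
    {a : CrossedAlgebra α} (ha : a ∈ filt α 1) : a ∈ Ring.jacobson (CrossedAlgebra α) := by
  rw [← Ideal.jacobson_bot, Ideal.mem_jacobson_iff]
  intro y
  have h1 : y * a ∈ filt α 1 := by
    simpa using mul_mem_filt (mem_filt_zero y) ha
  have hpow : ∀ m : ℕ, (y * a) ^ m ∈ filt α m := by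
    intro m
    induction m with
    | zero => exact mem_filt_zero _
    | succ m ih => rw [pow_succ]; exact mul_mem_filt ih h1
  have hnil : IsNilpotent (y * a) := ⟨n, eq_zero_of_mem_filt hn (hpow n)⟩
  obtain ⟨z, hz⟩ := hnil.isUnit_one_add.exists_left_inv
  refine ⟨z, ?_⟩
  rw [Ideal.mem_bot, mul_assoc, sub_eq_zero, ← hz, mul_add, mul_one, add_comm]

end CrossedAlgebra

theorem CharP.natCast_ne_zero_of_coprime (F : Type*) [Field F] {p n : ℕ} [Fact p.Prime] [CharP F p]
    (h : n.Coprime p) : (n : F) ≠ 0 := by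
  intro h0
  rw [CharP.cast_eq_zero_iff F p] at h0
  have := Nat.dvd_gcd h0 dvd_rfl
  rw [h.gcd_eq_one, Nat.dvd_one] at this
  exact (Fact.out : p.Prime).one_lt.ne' this

/-! ### Normal form of a class in HH¹(A) -/

namespace derivationAlgebra

variable {k : Type u} [CommRing k] {A : Type v} [Ring A] [Algebra k A]

theorem apply_mul (f : derivationAlgebra k A) (a b : A) : f.1 (a * b) = f.1 a * b + a * f.1 b :=
  f.2 a b

theorem apply_one (f : derivationAlgebra k A) : f.1 1 = 0 := by
  have h := apply_mul f 1 1
  rwa [mul_one, mul_one, one_mul, left_eq_add] at h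

theorem lie_apply (f g : derivationAlgebra k A) (a : A) :
    (⁅f, g⁆ : derivationAlgebra k A).1 a = f.1 (g.1 a) - g.1 (f.1 a) := rfl

/-- The difference of a derivation and the inner derivation `[c, -]`. -/
def subInner (f : derivationAlgebra k A) (c : A) : derivationAlgebra k A :=
  ⟨f.1 - (LinearMap.mulLeft k c - LinearMap.mulRight k c), fun a b => by
    simp only [LinearMap.sub_apply, LinearMap.mulLeft_apply, LinearMap.mulRight_apply, apply_mul]
    noncomm_ring⟩

theorem subInner_apply (f : derivationAlgebra k A) (c a : A) :
    (subInner f c).1 a = f.1 a - (c * a - a * c) := rfl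

theorem mk_subInner (f : derivationAlgebra k A) (c : A) :
    HochschildOne.mk k A (subInner f c) = HochschildOne.mk k A f := by
  refine (Submodule.Quotient.eq _).2 ⟨-c, fun a => ?_⟩
  have h : (subInner f c - f).1 a = (subInner f c).1 a - f.1 a := rfl
  rw [h, subInner_apply]
  noncomm_ring

end derivationAlgebra

namespace CrossedAlgebra

open MonoidAlgebra derivationAlgebra

variable {k : Type v} [Field k] {P : Type u} [CommGroup P] {E : Subgroup (MulAut P)}
  {α : TwoCocycle E k}

variable (α) in
/-- The inverses of the basis elements indexed by `e ∈ E`. -/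
noncomputable def genInv (e : E) : CrossedAlgebra α := ((gen_isUnit (α := α) e).unit⁻¹ : _ˣ)

theorem gen_mul_genInv (e : E) : gen α e * genInv α e = 1 := (gen_isUnit (α := α) e).mul_val_inv

theorem genInv_mul_gen (e : E) : genInv α e * gen α e = 1 := (gen_isUnit (α := α) e).val_inv_mul

theorem gen_mul_eq (e f : E) :
    gen α (e * f) = (((α.normalized e f)⁻¹ : kˣ) : k) • (gen α e * gen α f) := by
  rw [gen_mul_gen, smul_smul, Units.inv_mul, one_smul]

theorem genInv_mul_mul_gen (e f : E) :
    genInv α (e * f) * gen α e = (α.normalized e f : k) • genInv α f := by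
  have h : genInv α (e * f) * (gen α e * gen α f) = (α.normalized e f : k) • 1 := by
    rw [gen_mul_gen, mul_smul_comm, genInv_mul_gen]
  calc genInv α (e * f) * gen α e
      = genInv α (e * f) * (gen α e * gen α f) * genInv α f := by
        rw [mul_assoc, mul_assoc, gen_mul_genInv, mul_one]
    _ = _ := by rw [h, smul_mul_assoc, one_mul]

theorem gen_mul_incl_mul_genInv (e : E) (x : MonoidAlgebra k P) :
    gen α e * incl α x * genInv α e = incl α (act k (e : MulAut P) x) := by
  rw [gen_mul_incl, mul_assoc, gen_mul_genInv, mul_one]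

/-- An averaging argument in the manner of Maschke: D(ê)ê⁻¹ is a 1-cocycle of E with values in A
under conjugation, and the mean of its values is the required c, since |E| is invertible. -/
theorem exists_inner_gen [Finite E] (hE : (Nat.card E : k) ≠ 0)
    (D : derivationAlgebra k (CrossedAlgebra α)) :
    ∃ c, ∀ e, D.1 (gen α e) = c * gen α e - gen α e * c := by
  have := Fintype.ofFinite E
  set γ : E → CrossedAlgebra α := fun f => D.1 (gen α f) * genInv α f with hγ
  have h1 : ∀ e f, γ (e * f) * gen α e = D.1 (gen α e) + gen α e * γ f := by
    intro e f
    rw [hγ]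
    simp only
    rw [mul_assoc, genInv_mul_mul_gen, mul_smul_comm, ← smul_mul_assoc, ← map_smul, ← gen_mul_gen,
      apply_mul, add_mul, mul_assoc, gen_mul_genInv, mul_one, mul_assoc]
  refine ⟨(Nat.card E : k)⁻¹ • ∑ f, γ f, fun e => ?_⟩
  have h2 : (∑ f, γ f) * gen α e = (Nat.card E : k) • D.1 (gen α e) + gen α e * ∑ f, γ f := by
    conv_lhs => rw [← Fintype.sum_equiv (Equiv.mulLeft e) (fun f => γ (e * f)) γ fun f => rfl]
    rw [Finset.sum_mul, Finset.sum_congr rfl fun f _ => h1 e f, Finset.sum_add_distrib, Finset.mul_sum,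
      Finset.sum_const, Finset.card_univ, Nat.cast_smul_eq_nsmul, Nat.card_eq_fintype_card]
  rw [smul_mul_assoc, mul_smul_comm, h2, smul_add, add_sub_cancel_right, smul_smul,
    inv_mul_cancel₀ hE, one_smul]

theorem apply_genInv {D : derivationAlgebra k (CrossedAlgebra α)} (hD : ∀ e, D.1 (gen α e) = 0)
    (e : E) : D.1 (genInv α e) = 0 := by
  have h := apply_mul D (gen α e) (genInv α e)
  rw [gen_mul_genInv, apply_one, hD, zero_mul, zero_add] at h
  rw [← one_mul (D.1 _), ← genInv_mul_gen e, mul_assoc, ← h, mul_zero]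

theorem apply_incl_act {D : derivationAlgebra k (CrossedAlgebra α)} (hD : ∀ e, D.1 (gen α e) = 0)
    (e : E) (x : MonoidAlgebra k P) :
    D.1 (incl α (act k (e : MulAut P) x)) = gen α e * D.1 (incl α x) * genInv α e := by
  rw [← gen_mul_incl_mul_genInv, apply_mul, apply_mul, hD, apply_genInv hD, zero_mul, zero_add,
    mul_zero, add_zero]

theorem cmp_one_apply_incl_act {D : derivationAlgebra k (CrossedAlgebra α)}
    (hD : ∀ e, D.1 (gen α e) = 0) (e : E) (x : MonoidAlgebra k P) :
    cmp α 1 (D.1 (incl α (act k (e : MulAut P) x))) =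
      act k (e : MulAut P) (cmp α 1 (D.1 (incl α x))) := by
  have h : D.1 (incl α (act k (e : MulAut P) x)) * gen α e = gen α e * D.1 (incl α x) := by
    rw [apply_incl_act hD, mul_assoc, genInv_mul_gen, mul_one]
  have h1 := cmp_mul_gen e 1 (D.1 (incl α (act k (e : MulAut P) x)))
  have h2 := cmp_gen_mul e 1 (D.1 (incl α x))
  rw [TwoCocycle.normalized_one_left, Units.val_one, one_smul, one_mul, h] at h1
  rw [TwoCocycle.normalized_one_right, Units.val_one, one_smul, mul_one, h1] at h2
  exact h2

/-- Subtracting [c, -] may spoil D(ê) = 0. Replacing c by the average of its conjugates under E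
restores this, and the condition on k[P] persists because W is stable under conjugation. -/
theorem exists_commuting_inner [Finite E] (hE : (Nat.card E : k) ≠ 0)
    (W : Submodule k (CrossedAlgebra α)) (hW : ∀ e, ∀ a ∈ W, gen α e * a * genInv α e ∈ W)
    {D : derivationAlgebra k (CrossedAlgebra α)} (hD : ∀ e, D.1 (gen α e) = 0)
    {c : CrossedAlgebra α} (hc : ∀ x, (subInner D c).1 (incl α x) ∈ W) :
    ∃ c', (∀ e, (subInner D c').1 (gen α e) = 0) ∧ ∀ x, (subInner D c').1 (incl α x) ∈ W := by
  have := Fintype.ofFinite E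
  set γ : E → CrossedAlgebra α := fun f => gen α f * c * genInv α f with hγ
  have h1 : ∀ e f, γ (e * f) * gen α e = gen α e * γ f := by
    intro e f
    simp only [hγ]
    rw [mul_assoc, genInv_mul_mul_gen, gen_mul_eq, mul_smul_comm, smul_mul_assoc, smul_mul_assoc,
      smul_smul, Units.mul_inv, one_smul]
    simp only [mul_assoc]
  refine ⟨(Nat.card E : k)⁻¹ • ∑ f, γ f, fun e => ?_, fun x => ?_⟩
  · have h2 : (∑ f, γ f) * gen α e = gen α e * ∑ f, γ f := by
      conv_lhs => rw [← Fintype.sum_equiv (Equiv.mulLeft e) (fun f => γ (e * f)) γ fun f => rfl]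
      rw [Finset.sum_mul, Finset.sum_congr rfl fun f _ => h1 e f, Finset.mul_sum]
    rw [subInner_apply, hD, smul_mul_assoc, mul_smul_comm, h2, sub_self, sub_zero]
  · have h3 : (subInner D ((Nat.card E : k)⁻¹ • ∑ f, γ f)).1 (incl α x) =
        (Nat.card E : k)⁻¹ • ∑ f : E, (subInner D (γ f)).1 (incl α x) := by
      simp only [subInner_apply]
      rw [Finset.sum_sub_distrib, Finset.sum_const, Finset.card_univ, Finset.sum_sub_distrib,
        ← Finset.sum_mul, ← Finset.mul_sum, smul_sub, ← Nat.cast_smul_eq_nsmul k, smul_smul,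
        ← Nat.card_eq_fintype_card, inv_mul_cancel₀ hE, one_smul, smul_sub, smul_mul_assoc,
        mul_smul_comm]
    rw [h3]
    refine W.smul_mem _ (W.sum_mem fun f _ => ?_)
    obtain ⟨y, hxy⟩ : ∃ y, x = act k (f : MulAut P) y := ⟨act k ((f⁻¹ : E) : MulAut P) x, by
      rw [act_act, ← Subgroup.coe_mul, mul_inv_cancel, Subgroup.coe_one, act_one]⟩
    have h4 : (subInner D (γ f)).1 (incl α x) =
        gen α f * (subInner D c).1 (incl α y) * genInv α f := by
      rw [subInner_apply, subInner_apply, hxy, apply_incl_act hD, ← gen_mul_incl_mul_genInv f y]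
      simp only [hγ, mul_sub, sub_mul]
      have h5 : ∀ a b : CrossedAlgebra α, gen α f * a * genInv α f * (gen α f * b * genInv α f) =
          gen α f * (a * b) * genInv α f := by
        intro a b
        calc _ = gen α f * a * (genInv α f * gen α f) * (b * genInv α f) := by
              simp only [mul_assoc]
          _ = _ := by rw [genInv_mul_gen, mul_one]; simp only [mul_assoc]
      rw [h5, h5]
    rw [h4]
    exact hW f _ (hc y)

variable (α) in
/-- The subspace `I(k[P]) + I² A` of the crossed algebra `A`, where `I` is the augmentation ideal. -/
noncomputable def untwistedFilt : Submodule k (CrossedAlgebra α) :=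
  ((augIdeal k P).restrictScalars k).map (incl α).toLinearMap ⊔ filt α 2

theorem mem_untwistedFilt {a : CrossedAlgebra α} :
    a ∈ untwistedFilt α ↔ cmp α 1 a ∈ augIdeal k P ∧ a - incl α (cmp α 1 a) ∈ filt α 2 := by
  constructor
  · intro ha
    obtain ⟨_, ⟨x, hx, rfl⟩, z, hz, rfl⟩ := Submodule.mem_sup.1 ha
    rw [AlgHom.toLinearMap_apply, map_add, cmp_incl_one, map_add, add_sub_add_left_eq_sub]
    have hz1 := mem_filt.1 hz 1
    exact ⟨add_mem hx (Ideal.pow_le_self two_ne_zero hz1), sub_mem hz (incl_mem_filt hz1)⟩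
  · rintro ⟨h1, h2⟩
    rw [← add_sub_cancel (incl α (cmp α 1 a)) a]
    exact Submodule.add_mem_sup ⟨_, h1, rfl⟩ h2

theorem untwistedFilt_le : untwistedFilt α ≤ filt α 1 := by
  refine sup_le ?_ (filt_le 1)
  rintro _ ⟨x, hx, rfl⟩
  refine incl_mem_filt ?_
  rwa [pow_one]

theorem conj_mem_filt {n : ℕ} (e : E) {a : CrossedAlgebra α} (ha : a ∈ filt α n) [Finite E] :
    gen α e * a * genInv α e ∈ filt α n := by
  have h1 := mul_mem_filt (mem_filt_zero (gen α e)) ha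
  have h2 := mul_mem_filt h1 (mem_filt_zero (genInv α e))
  rwa [zero_add, add_zero] at h2

theorem conj_mem_untwistedFilt [Finite E] (e : E) {a : CrossedAlgebra α}
    (ha : a ∈ untwistedFilt α) : gen α e * a * genInv α e ∈ untwistedFilt α := by
  obtain ⟨_, ⟨x, hx, rfl⟩, z, hz, rfl⟩ := Submodule.mem_sup.1 ha
  rw [mul_add, add_mul, AlgHom.toLinearMap_apply, gen_mul_incl_mul_genInv]
  refine Submodule.add_mem_sup ⟨_, ?_, rfl⟩ (conj_mem_filt e hz)
  have hx' : x ∈ augIdeal k P := hx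
  rw [← pow_one (augIdeal k P)] at hx'
  have := act_mem_augIdeal_pow (e : MulAut P) hx'
  rwa [pow_one] at this

/-- The component at `e ∈ E` of the restriction of a derivation to `k[P]`. -/
noncomputable def comp (D : derivationAlgebra k (CrossedAlgebra α)) (e : E) :
    MonoidAlgebra k P →ₗ[k] MonoidAlgebra k P :=
  cmp α e ∘ₗ D.1 ∘ₗ (incl α).toLinearMap

theorem comp_apply (D : derivationAlgebra k (CrossedAlgebra α)) (e : E) (x : MonoidAlgebra k P) :
    comp D e x = cmp α e (D.1 (incl α x)) := rfl

theorem comp_mul (D : derivationAlgebra k (CrossedAlgebra α)) (e : E) (x y : MonoidAlgebra k P) :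
    comp D e (x * y) = comp D e x * act k (e : MulAut P) y + x * comp D e y := by
  simp only [comp_apply, map_mul, apply_mul, map_add, cmp_incl_mul, cmp_mul_incl]

theorem comp_one_mul (D : derivationAlgebra k (CrossedAlgebra α)) (x y : MonoidAlgebra k P) :
    comp D 1 (x * y) = comp D 1 x * y + x * comp D 1 y := by
  rw [comp_mul, OneMemClass.coe_one, act_one]

/-- Every class in the first Hochschild cohomology of the crossed algebra is represented by a
derivation which vanishes on the basis elements indexed by `E` and maps `k[P]` to `I + I² A`. -/
theorem exists_representative {p : ℕ} [Fact p.Prime] [CharP k p] [Finite P] (hP : IsPGroup p P)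
    (hE : (Nat.card E).Coprime p) (hPE : autCommutator E = ⊤)
    (c : HochschildOne k (CrossedAlgebra α)) :
    ∃ D : derivationAlgebra k (CrossedAlgebra α), HochschildOne.mk k _ D = c ∧
      (∀ e, D.1 (gen α e) = 0) ∧ ∀ x, D.1 (incl α x) ∈ untwistedFilt α := by
  have : Finite (MulAut P) := Finite.of_injective (fun e : MulAut P => (e : P → P))
    DFunLike.coe_injective
  have : Finite E := inferInstance
  have := Fintype.ofFinite E
  have hcard := CharP.natCast_ne_zero_of_coprime k hE
  obtain ⟨D₀, rfl⟩ := Submodule.Quotient.mk_surjective _ c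
  obtain ⟨c₀, hc₀⟩ := exists_inner_gen hcard D₀
  set D := subInner D₀ c₀ with hD_def
  have hD : ∀ e, D.1 (gen α e) = 0 := fun e => by rw [hD_def, subInner_apply, hc₀, sub_self]
  have hex : ∀ e : E, ∃ x : MonoidAlgebra k P, e ≠ 1 → ∀ u : P,
      comp D e (of k P u) - x * (of k P ((e : MulAut P) u) - of k P u) ∈ augIdeal k P ^ 2 := by
    intro e
    by_cases he : e = 1
    · exact ⟨0, fun h => absurd he h⟩
    · have hem : (e : MulAut P) ^ Nat.card E = 1 := by
        rw [← Subgroup.coe_pow, pow_card_eq_one', Subgroup.coe_one]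
      obtain ⟨x, hx⟩ := exists_twistedDerivation_sub_mem_sq (k := k) hP hE hem
        (fun h => he (Subtype.ext h)) (comp D e) (comp_mul D e)
      exact ⟨x, fun _ => hx⟩
  choose x hx using hex
  -- The component of [c₁, u] at e is x(e)(e(u) - u), so a single inner derivation corrects all e ≠
  -- 1 at once. The component at 1 is unchanged since k[P] is commutative.
  set c₁ := ∑ e : E, incl α (x e) * gen α e with hc₁
  have hcmp : ∀ e, cmp α e c₁ = x e := by
    intro e
    rw [hc₁, map_sum, Finset.sum_eq_single e]
    · rw [cmp_incl_mul, cmp_gen_self, mul_one]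
    · intro f _ hf
      rw [cmp_incl_mul, cmp_gen_of_ne hf, mul_zero]
    · simp
  have hsub : ∀ e u, cmp α e ((subInner D c₁).1 (incl α (of k P u))) =
      comp D e (of k P u) - x e * (of k P ((e : MulAut P) u) - of k P u) := by
    intro e u
    rw [subInner_apply, map_sub, map_sub, cmp_mul_incl, cmp_incl_mul, hcmp, act_of, comp_apply]
    ring
  have hW : ∀ y, (subInner D c₁).1 (incl α y) ∈ untwistedFilt α := by
    refine map_mem_of_forall_of ((subInner D c₁).1 ∘ₗ (incl α).toLinearMap) _ fun u => ?_
    rw [LinearMap.comp_apply, AlgHom.toLinearMap_apply, mem_untwistedFilt]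
    constructor
    · rw [hsub, OneMemClass.coe_one, MulAut.one_apply, sub_self, mul_zero, sub_zero]
      exact derivation_mem_augIdeal hPE (comp D 1) (comp_one_mul D)
        (fun e he y => cmp_one_apply_incl_act hD ⟨e, he⟩ y) _
    · refine mem_filt.2 fun e => ?_
      by_cases he : e = 1
      · rw [he, map_sub, cmp_incl_one, sub_self]
        exact zero_mem _
      · rw [map_sub, cmp_incl_of_ne he, sub_zero, hsub]
        exact hx e he u
  obtain ⟨c₂, h1, h2⟩ := exists_commuting_inner hcard (untwistedFilt α)
    (fun e a ha => conj_mem_untwistedFilt e ha) hD hW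
  exact ⟨subInner D c₂, by rw [mk_subInner, hD_def, mk_subInner], h1, h2⟩

/-- By the Leibniz rule, a derivation killing every ê and sending k[P] into Iⁿ⁺¹A raises degrees by
n: one factor from I is lost and n + 1 are gained. -/
theorem apply_mem_filt_add [Finite E] {D : derivationAlgebra k (CrossedAlgebra α)}
    (hD : ∀ e, D.1 (gen α e) = 0) {n : ℕ} (hn : ∀ x, D.1 (incl α x) ∈ filt α (n + 1)) {m : ℕ}
    {a : CrossedAlgebra α} (ha : a ∈ filt α m) : D.1 a ∈ filt α (m + n) := by
  have := Fintype.ofFinite E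
  have hincl : ∀ m, ∀ x ∈ augIdeal k P ^ m, D.1 (incl α x) ∈ filt α (m + n) := by
    intro m
    induction m with
    | zero => intro x _; rw [zero_add]; exact filt_le n (hn x)
    | succ m ih =>
      intro x hx
      rw [pow_succ] at hx
      induction hx using Submodule.mul_induction_on' with
      | mem_mul_mem y hy z hz =>
        rw [map_mul, apply_mul]
        refine add_mem ?_ ?_
        · rw [add_right_comm]
          rw [← pow_one (augIdeal k P)] at hz
          exact mul_mem_filt (ih y hy) (incl_mem_filt hz)
        · rw [add_assoc, add_comm 1 n]
          exact mul_mem_filt (incl_mem_filt hy) (hn z)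
      | add y _ z _ hy hz => rw [map_add, map_add]; exact add_mem hy hz
  rw [← sum_incl_cmp_mul_gen a, map_sum]
  refine Submodule.sum_mem _ fun e _ => ?_
  rw [apply_mul, hD, mul_zero, add_zero]
  exact mul_gen_mem_filt (hincl m _ (mem_filt.1 ha e)) e

end CrossedAlgebra

/-! ### Solvability in the multiplicity free case -/

/-- A quotient of a Lie algebra is solvable if it is covered by the first term of a sequence of
subspaces which ends at zero, and each of which contains the brackets of its predecessor. -/
theorem LieAlgebra.isSolvable_quotient_of_sequence {k : Type u} [CommRing k] {L : Type v} [LieRing L]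
    [LieAlgebra k L] (I : LieIdeal k L) (W : ℕ → Submodule k L)
    (h0 : ∀ c : L ⧸ I, ∃ D ∈ W 0, LieSubmodule.Quotient.mk D = c)
    (hW : ∀ n, ∀ D ∈ W n, ∀ D' ∈ W n, ⁅D, D'⁆ ∈ W (n + 1)) {n : ℕ} (hn : W n = ⊥) :
    LieAlgebra.IsSolvable (L ⧸ I) := by
  have key : ∀ n, ∀ c ∈ LieAlgebra.derivedSeries k (L ⧸ I) n, ∃ D ∈ W n,
      (LieSubmodule.Quotient.mk D : L ⧸ I) = c := by
    intro n
    induction n with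
    | zero => intro c _; exact h0 c
    | succ n ih =>
      intro c hc
      rw [LieAlgebra.derivedSeries_def, LieAlgebra.derivedSeriesOfIdeal_succ,
        ← LieAlgebra.derivedSeries_def, ← LieSubmodule.mem_toSubmodule,
        LieSubmodule.lieIdeal_oper_eq_linear_span'] at hc
      induction hc using Submodule.span_induction with
      | mem c hc =>
        obtain ⟨x, hx, y, hy, rfl⟩ := hc
        obtain ⟨D, hD, rfl⟩ := ih x hx
        obtain ⟨D', hD', rfl⟩ := ih y hy
        exact ⟨⁅D, D'⁆, hW n D hD D' hD', LieSubmodule.Quotient.mk_bracket I D D'⟩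
      | zero => exact ⟨0, (W _).zero_mem, rfl⟩
      | add x y _ _ hx hy =>
        obtain ⟨D, hD, rfl⟩ := hx
        obtain ⟨D', hD', rfl⟩ := hy
        exact ⟨D + D', (W _).add_mem hD hD', rfl⟩
      | smul r x _ hx =>
        obtain ⟨D, hD, rfl⟩ := hx
        exact ⟨r • D, (W _).smul_mem r hD, rfl⟩
  refine LieAlgebra.IsSolvable.mk (R := k) (k := n) ?_
  rw [eq_bot_iff]
  intro c hc
  obtain ⟨D, hD, rfl⟩ := key n c hc
  rw [hn, Submodule.mem_bot] at hD
  rw [hD]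
  exact LieSubmodule.zero_mem _

namespace CrossedAlgebra

open MonoidAlgebra derivationAlgebra

variable {k : Type v} [Field k] {P : Type u} [CommGroup P] {E : Subgroup (MulAut P)}
  {α : TwoCocycle E k}

/-- The derivations which vanish on the basis elements indexed by `E` and map `k[P]` to a given
subspace. -/
def relDerivations (N : Submodule k (CrossedAlgebra α)) :
    Submodule k (derivationAlgebra k (CrossedAlgebra α)) where
  carrier := {D | (∀ e, D.1 (gen α e) = 0) ∧ ∀ x, D.1 (incl α x) ∈ N}
  zero_mem' := ⟨fun _ => rfl, fun _ => N.zero_mem⟩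
  add_mem' := fun {D D'} hD hD' => ⟨fun e => by
    change D.1 (gen α e) + D'.1 (gen α e) = 0
    rw [hD.1, hD'.1, add_zero], fun x => N.add_mem (hD.2 x) (hD'.2 x)⟩
  smul_mem' := fun r D hD => ⟨fun e => by
    change r • D.1 (gen α e) = 0
    rw [hD.1, smul_zero], fun x => N.smul_mem r (hD.2 x)⟩

theorem lie_apply_gen {D D' : derivationAlgebra k (CrossedAlgebra α)}
    (hD : ∀ e, D.1 (gen α e) = 0) (hD' : ∀ e, D'.1 (gen α e) = 0) (e : E) :
    (⁅D, D'⁆ : derivationAlgebra k (CrossedAlgebra α)).1 (gen α e) = 0 := by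
  rw [lie_apply, hD, hD', map_zero, map_zero, sub_zero]

theorem apply_mem_filt [Finite E] {D : derivationAlgebra k (CrossedAlgebra α)}
    (hD : ∀ e, D.1 (gen α e) = 0) {n : ℕ} (hn : ∀ x, D.1 (incl α x) ∈ filt α n)
    (a : CrossedAlgebra α) : D.1 a ∈ filt α n := by
  have := Fintype.ofFinite E
  rw [← sum_incl_cmp_mul_gen a, map_sum]
  refine Submodule.sum_mem _ fun e _ => ?_
  rw [apply_mul, hD, mul_zero, add_zero]
  exact mul_gen_mem_filt (hn _) e

/-- Modulo I²A only the components at 1 matter: the others already lie in I²A, which D preserves. -/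
theorem apply_apply_sub_mem [Finite E] {D D' : derivationAlgebra k (CrossedAlgebra α)}
    (hD : D ∈ relDerivations (untwistedFilt α)) (hD' : D' ∈ relDerivations (untwistedFilt α))
    (x : MonoidAlgebra k P) :
    D.1 (D'.1 (incl α x)) - incl α (comp D 1 (comp D' 1 x)) ∈ filt α 2 := by
  have h1 := (mem_untwistedFilt.1 (hD'.2 x)).2
  have h2 := apply_mem_filt_add (n := 0) hD.1 (fun y => untwistedFilt_le (hD.2 y)) h1
  have h3 := (mem_untwistedFilt.1 (hD.2 (comp D' 1 x))).2
  have h4 := add_mem h2 h3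
  rw [add_zero, map_sub] at h4
  have h5 : D.1 (D'.1 (incl α x)) - incl α (comp D 1 (comp D' 1 x)) =
      D.1 (D'.1 (incl α x)) - D.1 (incl α (cmp α 1 (D'.1 (incl α x)))) +
      (D.1 (incl α (comp D' 1 x)) - incl α (cmp α 1 (D.1 (incl α (comp D' 1 x))))) := by
    simp only [comp_apply]
    abel
  rw [h5]
  exact h4

theorem lie_mem_relDerivations_two [Finite E] {w : P}
    (hE : ∀ e ∈ E, ∀ f ∈ E, e * f = f * e)
    (hw : ∀ N : Submodule k (MonoidAlgebra k P), (augIdeal k P ^ 2).restrictScalars k ≤ N →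
      (∀ e ∈ E, of k P (e w) - 1 ∈ N) → (augIdeal k P).restrictScalars k ≤ N)
    {D D' : derivationAlgebra k (CrossedAlgebra α)}
    (hD : D ∈ relDerivations (untwistedFilt α)) (hD' : D' ∈ relDerivations (untwistedFilt α)) :
    ⁅D, D'⁆ ∈ relDerivations (filt α 2) := by
  refine ⟨lie_apply_gen hD.1 hD'.1, fun x => ?_⟩
  have h1 := sub_mem (apply_apply_sub_mem hD hD' x) (apply_apply_sub_mem hD' hD x)
  have h2 := derivation_commutator_mem_sq hE hw (comp D 1) (comp D' 1) (comp_one_mul D)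
    (comp_one_mul D') (fun y => (mem_untwistedFilt.1 (hD.2 y)).1)
    (fun y => (mem_untwistedFilt.1 (hD'.2 y)).1)
    (fun e he y => cmp_one_apply_incl_act hD.1 ⟨e, he⟩ y)
    (fun e he y => cmp_one_apply_incl_act hD'.1 ⟨e, he⟩ y) x
  have h3 := add_mem h1 (incl_mem_filt (α := α) h2)
  rw [lie_apply]
  rw [map_sub] at h3
  convert h3 using 1
  abel

/-- A derivation sending k[P] into I²A raises degrees by one, so each of the two composites gains a
degree. -/
theorem lie_mem_relDerivations_succ [Finite E] {n : ℕ}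
    {D D' : derivationAlgebra k (CrossedAlgebra α)}
    (hD : D ∈ relDerivations (filt α (n + 2))) (hD' : D' ∈ relDerivations (filt α (n + 2))) :
    ⁅D, D'⁆ ∈ relDerivations (filt α (n + 3)) := by
  have hle : filt α (n + 2) ≤ filt α 2 := by
    induction n with
    | zero => exact le_rfl
    | succ n _ => exact fun a ha => mem_filt.2 fun e =>
        Ideal.pow_le_pow_right (by omega) (mem_filt.1 ha e)
  refine ⟨lie_apply_gen hD.1 hD'.1, fun x => ?_⟩
  rw [lie_apply]
  exact sub_mem (apply_mem_filt_add (n := 1) hD.1 (fun y => hle (hD.2 y)) (hD'.2 x))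
    (apply_mem_filt_add (n := 1) hD'.1 (fun y => hle (hD'.2 y)) (hD.2 x))

theorem relDerivations_eq_bot [Finite E] {n : ℕ} (hn : augIdeal k P ^ n = ⊥) :
    relDerivations (filt α n) = ⊥ := by
  rw [eq_bot_iff]
  intro D hD
  refine Subtype.ext (LinearMap.ext fun a => ?_)
  exact eq_zero_of_mem_filt hn (apply_mem_filt hD.1 hD.2 a)

theorem isSolvable_hochschildOne {p : ℕ} [Fact p.Prime] [CharP k p] [Finite P] (hP : IsPGroup p P)
    (hEcomm : ∀ e ∈ E, ∀ f ∈ E, e * f = f * e) (hE : (Nat.card E).Coprime p)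
    (hPE : autCommutator E = ⊤) (hmf : IsMultiplicityFree (MonoidAlgebra (ZMod p) E)
      (FrattiniQuotient.representation hP E).asModule) :
    LieAlgebra.IsSolvable (HochschildOne k (CrossedAlgebra α)) := by
  have : Finite (MulAut P) := Finite.of_injective (fun e : MulAut P => (e : P → P))
    DFunLike.coe_injective
  have : Finite E := inferInstance
  have : Finite (FrattiniQuotient.representation hP E).asModule :=
    Finite.of_surjective _ (FrattiniQuotient.mk_surjective hP)
  have hcomm : ∀ a b : MonoidAlgebra (ZMod p) E, a * b = b * a := by
    let _ : CommGroup E := { (inferInstance : Group E) with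
      mul_comm := fun e f => Subtype.ext (hEcomm e e.2 f f.2) }
    exact fun a b => mul_comm a b
  obtain ⟨x, hx⟩ := hmf.exists_span_singleton_eq_top hcomm
  obtain ⟨w, rfl⟩ := FrattiniQuotient.mk_surjective hP x
  have hw := augIdeal_le_of_span_eq_top (k := k) hP E (w := w) hx
  obtain ⟨n, hn⟩ := augIdeal_isNilpotent (k := k) hP
  have hn2 : augIdeal k P ^ (n + 2) = ⊥ := by rw [pow_add, hn, Ideal.bot_mul]
  refine LieAlgebra.isSolvable_quotient_of_sequence (innerDerivations k (CrossedAlgebra α))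
    -- The first term needs I + I²A in place of IA: the bracket enters I²A thanks to cyclicity, and
    -- from then on it climbs one degree per step.
    (fun i => Nat.casesOn i (relDerivations (untwistedFilt α))
      fun i => relDerivations (filt α (i + 2))) ?_ ?_ (n := n + 1) (relDerivations_eq_bot hn2)
  · intro c
    obtain ⟨D, h1, h2⟩ := exists_representative hP hE hPE c
    exact ⟨D, h2, h1⟩
  · rintro (_ | i) D hD D' hD'
    · exact lie_mem_relDerivations_two hEcomm hw hD hD'
    · exact lie_mem_relDerivations_succ hD hD'

end CrossedAlgebra

/-! ### The converse: derivations realising endomorphisms of P/Φ(P) -/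

/-- An additive map on an `𝔽_p`-vector space with values in a group of exponent `p` may be
prescribed on a basis. -/
theorem Module.Basis.exists_addMonoidHom_of_nsmul {p : ℕ} {ι V W : Type*} [AddCommGroup V]
    [Module (ZMod p) V] [AddCommGroup W] (hW : ∀ x : W, p • x = 0) (b : Module.Basis ι (ZMod p) V)
    (g : ι → W) : ∃ s : V →+ W, ∀ i, s (b i) = g i := by
  let _ : Module (ZMod p) W := AddCommGroup.zmodModule hW
  exact ⟨(b.constr ℕ g).toAddMonoidHom, fun i => b.constr_basis ℕ g i⟩

namespace LieAlgebra

variable {k : Type u} [CommRing k] {L : Type v} [LieRing L] [LieAlgebra k L] {I : LieIdeal k L}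

theorem mk_smul_mem_derivedSeries {n : ℕ} (r : k) {D : L}
    (hD : (LieSubmodule.Quotient.mk D : L ⧸ I) ∈ derivedSeries k (L ⧸ I) n) :
    (LieSubmodule.Quotient.mk (r • D) : L ⧸ I) ∈ derivedSeries k (L ⧸ I) n :=
  (derivedSeries k (L ⧸ I) n).toSubmodule.smul_mem r hD

theorem mk_lie_mem_derivedSeries_succ {n : ℕ} {D D' : L}
    (hD : (LieSubmodule.Quotient.mk D : L ⧸ I) ∈ derivedSeries k (L ⧸ I) n)
    (hD' : (LieSubmodule.Quotient.mk D' : L ⧸ I) ∈ derivedSeries k (L ⧸ I) n) :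
    (LieSubmodule.Quotient.mk ⁅D, D'⁆ : L ⧸ I) ∈ derivedSeries k (L ⧸ I) (n + 1) := by
  rw [derivedSeries_def, derivedSeriesOfIdeal_succ, ← derivedSeries_def,
    LieSubmodule.Quotient.mk_bracket]
  exact LieSubmodule.lie_mem_lie hD hD'

/-- A quotient of a Lie algebra is not solvable if there are predicates on the Lie algebra which are
related to each other by brackets as the members of an `𝔰𝔩₂`-triple are. -/
theorem not_isSolvable_quotient_of_sl2 (Ie If Ih : L → Prop) (he : ∃ D, Ie D) (hf : ∃ D, If D)
    (hh : ∃ D, Ih D) (hhe : ∀ D D', Ih D → Ie D' → ∃ r : k, Ie (r • ⁅D, D'⁆))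
    (hhf : ∀ D D', Ih D → If D' → ∃ r : k, If (r • ⁅D, D'⁆))
    (hef : ∀ D D', Ie D → If D' → Ih ⁅D, D'⁆)
    (h0 : ∀ D, Ie D → (LieSubmodule.Quotient.mk D : L ⧸ I) ≠ 0) : ¬ IsSolvable (L ⧸ I) := by
  -- Predicates replace fixed elements because a bracket recovers the triple only up to the error
  -- they permit; up to scalars, [h, e], [h, f] and [e, f] are again of types e, f and h.
  have key : ∀ n, ∃ De Df Dh : L,
      (Ie De ∧ (LieSubmodule.Quotient.mk De : L ⧸ I) ∈ derivedSeries k (L ⧸ I) n) ∧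
      (If Df ∧ (LieSubmodule.Quotient.mk Df : L ⧸ I) ∈ derivedSeries k (L ⧸ I) n) ∧
      (Ih Dh ∧ (LieSubmodule.Quotient.mk Dh : L ⧸ I) ∈ derivedSeries k (L ⧸ I) n) := by
    intro n
    induction n with
    | zero =>
      obtain ⟨De, hDe⟩ := he
      obtain ⟨Df, hDf⟩ := hf
      obtain ⟨Dh, hDh⟩ := hh
      exact ⟨De, Df, Dh, ⟨hDe, LieSubmodule.mem_top _⟩, ⟨hDf, LieSubmodule.mem_top _⟩,
        ⟨hDh, LieSubmodule.mem_top _⟩⟩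
    | succ n ih =>
      obtain ⟨De, Df, Dh, ⟨hDe, hDe'⟩, ⟨hDf, hDf'⟩, ⟨hDh, hDh'⟩⟩ := ih
      obtain ⟨r, hr⟩ := hhe _ _ hDh hDe
      obtain ⟨t, ht⟩ := hhf _ _ hDh hDf
      exact ⟨r • ⁅Dh, De⁆, t • ⁅Dh, Df⁆, ⁅De, Df⁆,
        ⟨hr, mk_smul_mem_derivedSeries r (mk_lie_mem_derivedSeries_succ hDh' hDe')⟩,
        ⟨ht, mk_smul_mem_derivedSeries t (mk_lie_mem_derivedSeries_succ hDh' hDf')⟩,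
        ⟨hef _ _ hDe hDf, mk_lie_mem_derivedSeries_succ hDe' hDf'⟩⟩
  intro hsol
  obtain ⟨n, hn⟩ := (isSolvable_iff k _).1 hsol
  obtain ⟨De, _, _, ⟨hDe, hDe'⟩, _⟩ := key n
  rw [hn, LieSubmodule.mem_bot] at hDe'
  exact h0 De hDe hDe'

end LieAlgebra

namespace FrattiniQuotient

open MonoidAlgebra

variable {k : Type v} [Field k] {P : Type u} [CommGroup P] {p : ℕ} (hP : IsPGroup p P)
  (E : Subgroup (MulAut P))

/-- The class of an element of `P` in the `𝔽_p E`-module `P / Φ(P)`. -/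
def cls (u : P) : (representation hP E).asModule :=
  (representation hP E).asModuleEquiv.symm (mk hP u)

variable {hP E}

theorem cls_mul (u v : P) : cls hP E (u * v) = cls hP E u + cls hP E v := rfl

theorem cls_one : cls hP E 1 = 0 := rfl

theorem cls_surjective : Function.Surjective (cls hP E) := mk_surjective hP

theorem cls_apply (e : E) (u : P) :
    cls hP E ((e : MulAut P) u) = of (ZMod p) E e • cls hP E u := by
  rw [cls, cls, ← Representation.asModuleEquiv_symm_map_rho]
  rfl

theorem cls_eq_cls_iff {u v : P} : cls hP E u = cls hP E v ↔ u⁻¹ * v ∈ frattini P :=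
  QuotientGroup.eq

/-- Since k[P] has exponent p, values may be prescribed on an 𝔽_p-basis of P/Φ(P). The congruence
spreads by additivity of u ↦ u - 1 modulo I², and does not depend on the representative because Φ(P)
- 1 lies in I². -/
theorem exists_additive_section [Fact p.Prime] [CharP k p] :
    ∃ s : (representation hP E).asModule →+ MonoidAlgebra k P,
      ∀ u, s (cls hP E u) - (of k P u - 1) ∈ augIdeal k P ^ 2 := by
  have hpK : ∀ x : MonoidAlgebra k P, p • x = 0 := fun x => by
    rw [← Nat.cast_smul_eq_nsmul k, CharP.cast_eq_zero, zero_smul]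
  let b := Module.Basis.ofVectorSpace (ZMod p) (representation hP E).asModule
  choose w hw using fun i => cls_surjective (hP := hP) (E := E) (b i)
  obtain ⟨s, hs⟩ := b.exists_addMonoidHom_of_nsmul hpK fun i => of k P (w i) - 1
  have hmul : ∀ u v, s (cls hP E u) - (of k P u - 1) ∈ augIdeal k P ^ 2 →
      s (cls hP E v) - (of k P v - 1) ∈ augIdeal k P ^ 2 →
      s (cls hP E (u * v)) - (of k P (u * v) - 1) ∈ augIdeal k P ^ 2 := by
    intro u v hu hv
    have := sub_mem (add_mem hu hv) (of_mul_sub_one_congr (k := k) u v)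
    rw [cls_mul, map_add]
    convert this using 1
    abel
  have hall : ∀ x : (representation hP E).asModule, ∃ u, cls hP E u = x ∧
      s (cls hP E u) - (of k P u - 1) ∈ augIdeal k P ^ 2 := by
    intro x
    have hx : x ∈ Submodule.span (ZMod p) (Set.range b) := b.span_eq ▸ Submodule.mem_top
    induction hx using Submodule.span_induction with
    | mem x hx =>
      obtain ⟨i, rfl⟩ := hx
      refine ⟨w i, hw i, ?_⟩
      rw [hw, hs, sub_self]
      exact zero_mem _
    | zero => exact ⟨1, cls_one, by rw [cls_one, map_zero, map_one, sub_self, sub_zero]; exact zero_mem _⟩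
    | add x y _ _ hx hy =>
      obtain ⟨u, rfl, hu⟩ := hx
      obtain ⟨v, rfl, hv⟩ := hy
      exact ⟨u * v, cls_mul u v, hmul u v hu hv⟩
    | smul n x _ hx =>
      obtain ⟨u, rfl, hu⟩ := hx
      rw [← ZMod.natCast_zmod_val n, Nat.cast_smul_eq_nsmul]
      generalize n.val = m
      induction m with
      | zero => exact ⟨1, by rw [zero_smul, cls_one], by
          rw [cls_one, map_zero, map_one, sub_self, sub_zero]; exact zero_mem _⟩
      | succ m ih =>
        obtain ⟨v, hv, hv'⟩ := ih
        exact ⟨v * u, by rw [cls_mul, hv, succ_nsmul], hmul v u hv' hu⟩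
  refine ⟨s, fun u => ?_⟩
  obtain ⟨v, hv, hv'⟩ := hall (cls hP E u)
  have hfr := cls_eq_cls_iff.1 hv
  have h1 := hmul v (v⁻¹ * u) hv' (by
    rw [show cls hP E (v⁻¹ * u) = 0 from (cls_eq_cls_iff (u := 1)).2 (by rwa [inv_one, one_mul]) |>.symm,
      map_zero, zero_sub]
    exact neg_mem ((of_sub_one_mem_augIdeal_sq_iff hP _).2 hfr))
  rwa [mul_inv_cancel_left] at h1

/-- The map `u ↦ u - 1` from `P / Φ(P)` to `I / I²` lifts to an `E`-equivariant additive map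
to `k[P]`. -/
theorem exists_equivariant_section [Fact p.Prime] [CharP k p] [Finite E]
    (hE : (Nat.card E : k) ≠ 0) :
    ∃ s : (representation hP E).asModule →+ MonoidAlgebra k P,
      (∀ u, s (cls hP E u) - (of k P u - 1) ∈ augIdeal k P ^ 2) ∧
      ∀ (e : E) x, s (of (ZMod p) E e • x) = act k (e : MulAut P) (s x) := by
  have := Fintype.ofFinite E
  obtain ⟨s₀, hs₀⟩ := exists_additive_section (k := k) (hP := hP) (E := E)
  -- The conjugates of the additive lift under E; each still lifts u ↦ u - 1 modulo I², and their
  -- mean is equivariant.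
  let t : E → (representation hP E).asModule →+ MonoidAlgebra k P := fun f =>
    { toFun := fun x => act k (f : MulAut P) (s₀ (of (ZMod p) E f⁻¹ • x))
      map_zero' := by rw [smul_zero, map_zero, map_zero]
      map_add' := fun x y => by rw [smul_add, map_add, map_add] }
  have ht : ∀ f x, t f x = act k (f : MulAut P) (s₀ (of (ZMod p) E f⁻¹ • x)) := fun _ _ => rfl
  let s : (representation hP E).asModule →+ MonoidAlgebra k P :=
    { toFun := fun x => (Nat.card E : k)⁻¹ • ∑ f, t f x
      map_zero' := by simp only [map_zero, Finset.sum_const_zero, smul_zero]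
      map_add' := fun x y => by simp only [map_add, Finset.sum_add_distrib, smul_add] }
  have hs : ∀ x, s x = (Nat.card E : k)⁻¹ • ∑ f, t f x := fun _ => rfl
  refine ⟨s, fun u => ?_, fun e x => ?_⟩
  · have h1 : s (cls hP E u) - (of k P u - 1) =
        (Nat.card E : k)⁻¹ • ∑ f, (t f (cls hP E u) - (of k P u - 1)) := by
      rw [hs, Finset.sum_sub_distrib, Finset.sum_const, Finset.card_univ, smul_sub,
        ← Nat.cast_smul_eq_nsmul k, smul_smul, ← Nat.card_eq_fintype_card, inv_mul_cancel₀ hE,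
        one_smul]
    rw [h1]
    refine ((augIdeal k P ^ 2).restrictScalars k).smul_mem _
      (((augIdeal k P ^ 2).restrictScalars k).sum_mem fun f _ => ?_)
    have h2 := act_mem_augIdeal_pow (f : MulAut P) (hs₀ (((f⁻¹ : E) : MulAut P) u))
    rw [map_sub, map_sub, act_of, map_one, ← MulAut.mul_apply, ← Subgroup.coe_mul, mul_inv_cancel,
      Subgroup.coe_one, MulAut.one_apply, cls_apply] at h2
    exact h2
  · rw [hs, hs, map_smul, map_sum]
    congr 1
    refine (Fintype.sum_equiv (Equiv.mulLeft e) _ _ fun f => ?_).symm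
    rw [ht, ht, act_act, Equiv.coe_mulLeft, smul_smul, ← map_mul, mul_inv_rev,
      inv_mul_cancel_right, Subgroup.coe_mul]

end FrattiniQuotient

namespace CrossedAlgebra

open MonoidAlgebra derivationAlgebra FrattiniQuotient

variable {k : Type v} [Field k] {P : Type u} [CommGroup P] {E : Subgroup (MulAut P)}
  {α : TwoCocycle E k} {p : ℕ} {hP : IsPGroup p P}

theorem basis_mul_incl (u : P) (e : E) (r : k) (x : MonoidAlgebra k P) :
    basis α u e r * incl α x = incl α (act k (e : MulAut P) x) * basis α u e r := by
  rw [basis_eq, smul_mul_assoc, mul_smul_comm, mul_assoc, gen_mul_incl, ← mul_assoc, ← mul_assoc,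
    ← map_mul, ← map_mul, mul_comm (of k P u)]

/-- An `E`-equivariant endomorphism of `P / Φ(P)`, followed by an equivariant map to `k[P]`,
defines a derivation of the crossed algebra. -/
theorem exists_derivation (s : (representation hP E).asModule →+ MonoidAlgebra k P)
    (hs : ∀ (e : E) x, s (of (ZMod p) E e • x) = act k (e : MulAut P) (s x))
    (T : Module.End (MonoidAlgebra (ZMod p) E) (representation hP E).asModule) :
    ∃ D : derivationAlgebra k (CrossedAlgebra α), ∀ u e r,
      D.1 (basis α u e r) = incl α (s (T (cls hP E u))) * basis α u e r := by
  -- Each basis element is scaled by s(T(u)) ∈ k[P]. The Leibniz rule holds since s ∘ T is additive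
  -- and equivariant, and k[P] is commutative.
  let D₀ : CrossedAlgebra α →ₗ[k] CrossedAlgebra α := Finsupp.linearCombination k
    fun g : P ⋊[E.subtype] E => incl α (s (T (cls hP E g.left))) *
      TwistedGroupAlgebra.single _ g 1
  have hD₀ : ∀ u e r, D₀ (basis α u e r) = incl α (s (T (cls hP E u))) * basis α u e r := by
    intro u e r
    have h : D₀ (basis α u e r) = (r * ((α.toFun 1 1)⁻¹ : kˣ)) •
        (incl α (s (T (cls hP E u))) * TwistedGroupAlgebra.single _ ⟨u, e⟩ 1) :=
      Finsupp.linearCombination_single k _ _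
    rw [h, ← mul_smul_comm, TwistedGroupAlgebra.smul_single, mul_one, basis]
  refine ⟨⟨D₀, fun a b => ?_⟩, hD₀⟩
  induction a using basis_induction with
  | zero => simp only [zero_mul, map_zero, add_zero]
  | add a a' ha ha' =>
    simp only [add_mul, map_add, ha, ha']
    abel
  | basis u e r =>
    induction b using basis_induction with
    | zero => simp only [mul_zero, map_zero, add_zero]
    | add b b' hb hb' =>
      simp only [mul_add, map_add, hb, hb']
      abel
    | basis v f t =>
      rw [hD₀, hD₀, ← mul_assoc (basis α u e r), basis_mul_incl, basis_mul_basis, hD₀, cls_mul,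
        cls_apply, map_add, map_smul, map_add, hs, map_add, add_mul]
      simp only [mul_assoc, basis_mul_basis]

/-- A derivation vanishing on the basis elements indexed by `E` and inducing, modulo the square of
the augmentation ideal, a given endomorphism of `P / Φ(P)`. -/
def Induces (s : (representation hP E).asModule →+ MonoidAlgebra k P)
    (T : Module.End (MonoidAlgebra (ZMod p) E) (representation hP E).asModule)
    (D : derivationAlgebra k (CrossedAlgebra α)) : Prop :=
  (∀ e, D.1 (gen α e) = 0) ∧
    ∀ u, D.1 (incl α (of k P u)) - incl α (s (T (cls hP E u))) ∈ filt α 2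

variable {s : (representation hP E).asModule →+ MonoidAlgebra k P}

theorem section_mem_augIdeal (hs : ∀ u, s (cls hP E u) - (of k P u - 1) ∈ augIdeal k P ^ 2)
    (x : (representation hP E).asModule) : s x ∈ augIdeal k P := by
  obtain ⟨u, rfl⟩ := cls_surjective x
  have := add_mem (Ideal.pow_le_self two_ne_zero (hs u)) (of_sub_one_mem_augIdeal (k := k) u)
  rwa [sub_add_cancel] at this

theorem exists_induces (hs : ∀ u, s (cls hP E u) - (of k P u - 1) ∈ augIdeal k P ^ 2)
    (hsE : ∀ (e : E) x, s (of (ZMod p) E e • x) = act k (e : MulAut P) (s x))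
    (T : Module.End (MonoidAlgebra (ZMod p) E) (representation hP E).asModule) :
    ∃ D : derivationAlgebra k (CrossedAlgebra α), Induces s T D := by
  obtain ⟨D, hD⟩ := exists_derivation (α := α) s hsE T
  refine ⟨D, fun e => ?_, fun u => ?_⟩
  · rw [gen, hD, cls_one, map_zero, map_zero, map_zero, zero_mul]
  · have h : D.1 (incl α (of k P u)) - incl α (s (T (cls hP E u))) =
        incl α (s (T (cls hP E u)) * (of k P u - 1)) := by
      rw [incl_of, hD, ← incl_of, mul_sub, mul_one, map_sub, map_mul]
    rw [h]
    exact incl_mem_filt (mem_augIdeal_sq_of_mul (section_mem_augIdeal hs _)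
      (of_sub_one_mem_augIdeal u))

theorem Induces.apply_incl_mem {T} {D : derivationAlgebra k (CrossedAlgebra α)}
    (hD : Induces s T D) (hs : ∀ u, s (cls hP E u) - (of k P u - 1) ∈ augIdeal k P ^ 2)
    (x : MonoidAlgebra k P) : D.1 (incl α x) ∈ filt α 1 := by
  refine map_mem_of_forall_of (D.1 ∘ₗ (incl α).toLinearMap) (filt α 1) (fun u => ?_) x
  have h2 := section_mem_augIdeal hs (T (cls hP E u))
  rw [← pow_one (augIdeal k P)] at h2
  have := add_mem (filt_le 1 (hD.2 u)) (incl_mem_filt h2)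
  rwa [sub_add_cancel] at this

/-- Modulo I²A, D' sends u to w - 1 with w a lift of T'(u), and D preserves I²A; so the composite is
read off from D(w). -/
theorem Induces.apply_apply_sub_mem [Finite E] {T T'} {D D' : derivationAlgebra k (CrossedAlgebra α)}
    (hD : Induces s T D) (hD' : Induces s T' D')
    (hs : ∀ u, s (cls hP E u) - (of k P u - 1) ∈ augIdeal k P ^ 2) (u : P) :
    D.1 (D'.1 (incl α (of k P u))) - incl α (s (T (T' (cls hP E u)))) ∈ filt α 2 := by
  obtain ⟨w, hw⟩ := cls_surjective (T' (cls hP E u))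
  have h1 := hD'.2 u
  rw [← hw] at h1 ⊢
  have h2 := add_mem h1 (incl_mem_filt (α := α) (hs w))
  have h3 := apply_mem_filt_add (n := 0) hD.1 (hD.apply_incl_mem hs) h2
  have h4 := add_mem h3 (hD.2 w)
  rw [map_sub (incl α), map_sub (incl α), sub_add_sub_cancel, map_sub, map_sub, map_one, apply_one,
    sub_zero, sub_add_sub_cancel] at h4
  exact h4

theorem Induces.lie [Finite E] {T T'} {D D' : derivationAlgebra k (CrossedAlgebra α)}
    (hD : Induces s T D) (hD' : Induces s T' D')
    (hs : ∀ u, s (cls hP E u) - (of k P u - 1) ∈ augIdeal k P ^ 2) :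
    Induces s (T * T' - T' * T) ⁅D, D'⁆ := by
  refine ⟨lie_apply_gen hD.1 hD'.1, fun u => ?_⟩
  have h := sub_mem (hD.apply_apply_sub_mem hD' hs u) (hD'.apply_apply_sub_mem hD hs u)
  rw [lie_apply, LinearMap.sub_apply, Module.End.mul_apply, Module.End.mul_apply, map_sub, map_sub]
  convert h using 1
  abel

/-- Removes the factors ±2 in [h, e] = 2e and [h, f] = -2f; this is where p must be odd. -/
theorem Induces.inv_smul {T T'} {D : derivationAlgebra k (CrossedAlgebra α)} (hD : Induces s T D)
    {r : k} (hr : r ≠ 0) (hT : ∀ x, s (T x) = r • s (T' x)) : Induces s T' (r⁻¹ • D) := by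
  refine ⟨fun e => ?_, fun u => ?_⟩
  · change r⁻¹ • D.1 (gen α e) = 0
    rw [hD.1, smul_zero]
  · change r⁻¹ • D.1 (incl α (of k P u)) - _ ∈ _
    have h := (filt α 2).smul_mem r⁻¹ (hD.2 u)
    rwa [smul_sub, hT, map_smul, smul_smul, inv_mul_cancel₀ hr, one_smul] at h

/-- An inner derivation has zero component at 1 on k[P], so s(T(u)) ∈ I². Hence any lift w of T(u)
satisfies w - 1 ∈ I², that is, w ∈ Φ(P). -/
theorem Induces.eq_zero_of_mk_eq_zero [Fact p.Prime] [CharP k p] {T}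
    {D : derivationAlgebra k (CrossedAlgebra α)} (hD : Induces s T D)
    (hs : ∀ u, s (cls hP E u) - (of k P u - 1) ∈ augIdeal k P ^ 2)
    (h0 : HochschildOne.mk k _ D = 0) : T = 0 := by
  obtain ⟨c, hc⟩ := (LieSubmodule.Quotient.mk_eq_zero' (N := innerDerivations k _)).1 h0
  ext x
  obtain ⟨u, rfl⟩ := cls_surjective x
  obtain ⟨w, hw⟩ := cls_surjective (T (cls hP E u))
  have h1 := mem_filt.1 (hD.2 u) 1
  rw [hc, map_sub, map_sub, cmp_mul_incl, cmp_incl_mul, cmp_incl_one, OneMemClass.coe_one, act_one,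
    mul_comm, sub_self, zero_sub, neg_mem_iff, ← hw] at h1
  have h2 := sub_mem h1 (hs w)
  rw [sub_sub_cancel, of_sub_one_mem_augIdeal_sq_iff hP] at h2
  rw [LinearMap.zero_apply, ← hw, ← cls_one, eq_comm, cls_eq_cls_iff, inv_one, one_mul]
  exact h2

theorem isMultiplicityFree_of_isSolvable [Fact p.Prime] [CharP k p] [Finite P] (hP : IsPGroup p P)
    (hE : (Nat.card E).Coprime p) (hp : Odd p)
    (hsol : LieAlgebra.IsSolvable (HochschildOne k (CrossedAlgebra α))) :
    IsMultiplicityFree (MonoidAlgebra (ZMod p) E) (representation hP E).asModule := by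
  have : Finite (MulAut P) := Finite.of_injective (fun e : MulAut P => (e : P → P))
    DFunLike.coe_injective
  have : Finite E := inferInstance
  by_contra hmf
  have : NeZero (Nat.card E : ZMod p) := ⟨CharP.natCast_ne_zero_of_coprime _ hE⟩
  obtain ⟨e, f, h, he0, hef, hhe, hhf⟩ := exists_sl2_of_not_isMultiplicityFree hmf
  obtain ⟨s, hs, hsE⟩ := exists_equivariant_section (hP := hP) (E := E) 
    (CharP.natCast_ne_zero_of_coprime k hE)
  have h2 : (2 : k) ≠ 0 := Ring.two_ne_zero (by
    rw [ringChar.eq k p]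
    rintro rfl
    exact absurd hp (by decide))
  refine LieAlgebra.not_isSolvable_quotient_of_sl2 (I := innerDerivations k (CrossedAlgebra α))
    (Induces s e) (Induces s f) (Induces s h) (exists_induces hs hsE e) (exists_induces hs hsE f)
    (exists_induces hs hsE h) (fun D D' hD hD' => ⟨(2 : k)⁻¹, ?_⟩)
    (fun D D' hD hD' => ⟨(-2 : k)⁻¹, ?_⟩) (fun D D' hD hD' => ?_)
    (fun D hD hD0 => he0 (hD.eq_zero_of_mk_eq_zero hs hD0)) hsol
  · refine (hD.lie hD' hs).inv_smul h2 fun x => ?_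
    rw [hhe, LinearMap.add_apply, map_add, two_smul]
  · refine (hD.lie hD' hs).inv_smul (neg_ne_zero.2 h2) fun x => ?_
    rw [hhf, LinearMap.neg_apply, LinearMap.add_apply, map_neg, map_add, neg_smul, two_smul]
  · have := hD.lie hD' hs
    rwa [hef] at this

end CrossedAlgebra

/-! ### The main theorem -/

theorem theorem1p3 {p : ℕ} [Fact p.Prime] {k : Type v} [Field k] [CharP k p]
    {P : Type u} [CommGroup P] [Finite P] [Nontrivial P] (hP : IsPGroup p P)
    (E : Subgroup (MulAut P)) (hEcomm : ∀ e ∈ E, ∀ f ∈ E, e * f = f * e)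
    (hE : (Nat.card E).Coprime p) (hPE : autCommutator E = ⊤) (α : TwoCocycle E k) :
    let A := TwistedGroupAlgebra
      (α.inflate (SemidirectProduct.rightHom : P ⋊[E.subtype] E →* E))
    (∀ c : HochschildOne k A, ∃ f : derivationAlgebra k A,
      HochschildOne.mk k A f = c ∧ ∀ a : A, f.1 a ∈ Ring.jacobson A) ∧
    (IsMultiplicityFree (MonoidAlgebra (ZMod p) E) (FrattiniQuotient.representation hP E).asModule →
      LieAlgebra.IsSolvable (HochschildOne k A)) ∧
    (Odd p → LieAlgebra.IsSolvable (HochschildOne k A) →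
      IsMultiplicityFree (MonoidAlgebra (ZMod p) E)
        (FrattiniQuotient.representation hP E).asModule) := by
  refine ⟨fun c => ?_, CrossedAlgebra.isSolvable_hochschildOne hP hEcomm hE hPE,
    fun hp hsol => CrossedAlgebra.isMultiplicityFree_of_isSolvable hP hE hp hsol⟩
  have : Finite (MulAut P) := Finite.of_injective (fun e : MulAut P => (e : P → P))
    DFunLike.coe_injective
  obtain ⟨D, rfl, hD, hDW⟩ := CrossedAlgebra.exists_representative hP hE hPE c
  obtain ⟨n, hn⟩ := MonoidAlgebra.augIdeal_isNilpotent (k := k) hP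
  exact ⟨D, rfl, fun a => CrossedAlgebra.mem_jacobson_of_mem_filt hn
    (CrossedAlgebra.apply_mem_filt hD (fun x => CrossedAlgebra.untwistedFilt_le (hDW x)) a)⟩
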